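/- **Setting.** There are $K$ arms. Playing arm $i$ at time $t$ yields a reward $X_i(t)$ with distribution $f_i$, of mean $\mu_i$ and sub-Gaussian with parameter $1/2$ (i.e. $\mathbb E[e^{s(X_i-\mu_i)}]\le e^{s^2/8}$ for all $s$); rewards at different times are independent. Let $i_{\max}$, $i_{\min}$ be arms of largest and smallest mean, $\Delta_i=\mu_{i_{\max}}-\mu_i$, and $\mathcal A=\{i:\Delta_i=0\}$. For $\epsilon>0$ let $\mathcal G^*$ be the graph on the arms in which $i\ne j$ are adjacent iff $|\mu_i-\mu_j|<\epsilon$; assume that $\mathcal G^*$ is connected. Let $N[i]$ be the closed neighbourhood of $i$ in $\mathcal G^*$. Two arms are equivalent if $N[i]=N[j]$; let $\mathcal B^*_{i}$ be the class of arm $i$. The classes are ordered by the means of their arms. Two classes are connected if some arm of one is adjacent to some arm of the other. **Assumptions.** (3) Every class that is neither the lowest nor the highest is connected to some lower class and to some higher class which are not connected to each other. (4) There is $\kappa>0$ such that every class has at least $\kappa\log K$ arms. (5) Every edge of $\mathcal G^*$ is put into $\mathcal E^S$ with probability $p_S$ and every non-edge into $\mathcal E^D$ with probability $p_D$, all independently,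 where $p_S^2p_D\ge 1-e^{-2/\kappa}$. Moreover $\Delta_i>4\epsilon$ for every $i\in\mathcal B^*_{i_{\min}}$. **Policy.** LSDT-PSI with input parameter $\lambda>0$ and horizon $T$ knows $\epsilon,\mathcal E^S,\mathcal E^D$. *Offline step*: $\mathcal B_0$ is the set of arms $i$ for which there are no $j,k$ with $(i,j),(i,k)\in\mathcal E^S$ and $(j,k)\in\mathcal E^D$. For $i\in\mathcal B_0$ let $N'[i]$ consist of $i$ and of all $j\in\mathcal B_0$ with $(i,j)\in\mathcal E^S$, and let $(z_i)_{i\in\mathcal B_0}$ minimize $\sum_i z_i$ subject to $z\ge0$ and $\sum_{j\in N'[i]}z_j\ge1$ for all $i\in\mathcal B_0$. *Online step*: let $\tilde\Delta_m=2^{-m}$ and $m_f=\max\{0,\min\{\lceil\log_2\frac{8}{\sqrt{2\lambda}\,\epsilon}\rceil,\lfloor\frac12\log_2\frac Te\rfloor\}\}$. In the epochs $m=0,\dots,m_f$: if $|\mathcal B_m|=1$, play the arm of $\mathcal B_m$ until time $T$. Otherwise play every arm $i\in\mathcal B_0$ with $N'[i]\cap\mathcal B_m\ne\emptyset$ until it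 has been played $\lceil\lambda z_i\log(T\tilde\Delta_m^2)/\tilde\Delta_m^2\rceil$ times in total. Then let $A_i$ be the average of all rewards observed so far from arms in $N'[i]$, $n_i$ their number, and $r_i=\sqrt{\log(T\tilde\Delta_m^2)/(2n_i)}$; obtain $\mathcal B_{m+1}$ from $\mathcal B_m$ by removing every $i$ with $A_i+r_i+\epsilon\le\max_{k\in\mathcal B_m}(A_k-r_k)$. After epoch $m_f$, at each time $t\le T$ play an arm of $\mathcal B_{m_f+1}$ that maximizes $\bar x_i(t-1)+\sqrt{2\log(t-1)/\tau_i(t-1)}$, where $\tau_i(t-1)$ and $\bar x_i(t-1)$ are the number of plays and the average reward of arm $i$ up to time $t-1$ (the index is $+\infty$ for an arm not played yet). Its regret is $R(T;\mathcal E^S,\mathcal E^D)=\mathbb E\big[\sum_{t=1}^T\mu_{i_{\max}}-\sum_{t=1}^TX_{\pi_t}(t)\big]$, where $\pi_t$ is the arm played at time $t$. **Claim.** For all $\lambda>0$, $p_S,p_D\in[0,1]$ and $0<\Delta_{\mathrm{lo}}\le\Delta_{\mathrm{hi}}$ there is a constant $C$, depending on nothing else (in particular not on $T$, $K$, $\epsilon$,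 $\kappa$ or the reward distributions), such that whenever the assumptions above hold and $\Delta_{\mathrm{lo}}\le\Delta_i\le\Delta_{\mathrm{hi}}$ for all $i\notin\mathcal A$, then for all sufficiently large $T$ $$\mathbb E_{\mathcal E^S,\mathcal E^D}\big[R(T;\mathcal E^S,\mathcal E^D)\big]\le C\,\big(1+|\mathcal B^*_{i_{\max}}\setminus\mathcal A|\big)\log T .$$ How large $T$ has to be may depend on the problem instance. -/

import Mathlib

open MeasureTheory ProbabilityTheory Filter

namespace LSDT

noncomputable section

/-! ### The unit interval graph of the arms -/

/-- The unit interval graph of the arms: distinct arms `i`, `j` are adjacent (similar) iff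
`|μ i - μ j| < ε`. -/
def uig {K : ℕ} (ε : ℝ) (μ : Fin K → ℝ) : SimpleGraph (Fin K) where
  Adj i j := i ≠ j ∧ |μ i - μ j| < ε
  symm := ⟨fun i j h => ⟨h.1.symm, by rw [abs_sub_comm]; exact h.2⟩⟩
  loopless := ⟨fun _ h => h.1 rfl⟩

/-- `N[i]`: the neighbours of `i`, including `i`. -/
def closedNbhd {K : ℕ} (G : SimpleGraph (Fin K)) (i : Fin K) : Set (Fin K) :=
  {j | j = i ∨ G.Adj i j}

open Classical in
/-- The neighbourhood equivalence class of `i`: all `j` with `N[j] = N[i]`. -/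
def nbhdClass {K : ℕ} (G : SimpleGraph (Fin K)) (i : Fin K) : Finset (Fin K) :=
  Finset.univ.filter fun j => closedNbhd G j = closedNbhd G i

/-- The class of `i` precedes the class of `j` along the real line. -/
def ClassLT {K : ℕ} (G : SimpleGraph (Fin K)) (μ : Fin K → ℝ) (i j : Fin K) : Prop :=
  ∀ a ∈ nbhdClass G i, ∀ b ∈ nbhdClass G j, μ a < μ b

/-- The classes of `i` and `j` are connected: some arm of one is adjacent to some arm of the
other. -/
def ClassAdj {K : ℕ} (G : SimpleGraph (Fin K)) (i j : Fin K) : Prop :=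
  ∃ a ∈ nbhdClass G i, ∃ b ∈ nbhdClass G j, G.Adj a b

/-- Topological diversity: every class which is neither the first nor the last one along the real
line is connected to a lower class and to a higher class that are not connected to each other. -/
def Diverse {K : ℕ} (G : SimpleGraph (Fin K)) (μ : Fin K → ℝ) : Prop :=
  ∀ i, (∃ a, ClassLT G μ a i) → (∃ b, ClassLT G μ i b) →
    ∃ j k, ClassLT G μ j i ∧ ClassLT G μ i k ∧
      ClassAdj G j i ∧ ClassAdj G k i ∧ ¬ ClassAdj G j k

open Classical in
/-- The arms with the largest mean reward. -/
def optArms {K : ℕ} (μ : Fin K → ℝ) : Finset (Fin K) :=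
  Finset.univ.filter fun i => ∀ j, μ j ≤ μ i

/-! ### Partial side information -/

open Classical in
/-- The edges of `G`, as a finite set of unordered pairs. -/
def edges {K : ℕ} (G : SimpleGraph (Fin K)) : Finset (Sym2 (Fin K)) :=
  Finset.univ.filter fun e => e ∈ G.edgeSet

open Classical in
/-- Expectation of `F ES ED` when every edge of `G` is put into `ES` with probability `pS` and
every non-edge of `G` (an edge of the complement graph) is put into `ED` with probability `pD`, all
independently. -/
def sideInfoExp {K : ℕ} (G : SimpleGraph (Fin K)) (pS pD : ℝ)
    (F : Finset (Sym2 (Fin K)) → Finset (Sym2 (Fin K)) → ℝ) : ℝ :=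
  ∑ ES ∈ (edges G).powerset, ∑ ED ∈ (edges Gᶜ).powerset,
    (pS ^ ES.card * (1 - pS) ^ (edges G \ ES).card) *
      (pD ^ ED.card * (1 - pD) ^ (edges Gᶜ \ ED).card) * F ES ED

/-! ### Offline elimination and exploration values -/

open Classical in
/-- Output `B₀` of the offline elimination step: an arm is removed if it is known to be similar to
two arms that are known to be dissimilar. -/
def remaining {K : ℕ} (ES ED : Finset (Sym2 (Fin K))) : Finset (Fin K) :=
  Finset.univ.filter fun i => ¬ ∃ j k, s(i, j) ∈ ES ∧ s(i, k) ∈ ES ∧ s(j, k) ∈ ED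

open Classical in
/-- `N'[i]`: the closed neighbourhood of `i` in the similarity graph restricted to `B₀`. -/
def simNbhd {K : ℕ} (ES ED : Finset (Sym2 (Fin K))) (i : Fin K) : Finset (Fin K) :=
  (remaining ES ED).filter fun j => j = i ∨ s(i, j) ∈ ES

/-- Feasible points of the linear program that defines the exploration values. -/
def LPFeasible {K : ℕ} (ES ED : Finset (Sym2 (Fin K))) (z : Fin K → ℝ) : Prop :=
  (∀ i ∈ remaining ES ED, 1 ≤ ∑ j ∈ simNbhd ES ED i, z j) ∧ ∀ i ∈ remaining ES ED, 0 ≤ z i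

/-- `z` is an optimal solution of that linear program (only its values on `B₀` matter). -/
def IsExplorationValue {K : ℕ} (ES ED : Finset (Sym2 (Fin K))) (z : Fin K → ℝ) : Prop :=
  LPFeasible ES ED z ∧
    ∀ z', LPFeasible ES ED z' → ∑ i ∈ remaining ES ED, z i ≤ ∑ i ∈ remaining ES ED, z' i

/-! ### Statistics of a run

A run is a sequence `arm` of played arms with the sequence `rew` of observed rewards. Rounds are
numbered from `0`, so the statistics "at `t`" are those of the first `t` rounds. -/

/-- The number of plays of arm `i` during the first `t` rounds. -/
def plays {K : ℕ} (arm : ℕ → Fin K) (i : Fin K) (t : ℕ) : ℕ :=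
  ((Finset.range t).filter fun s => arm s = i).card

/-- The average reward from arm `i` during the first `t` rounds. -/
def avg {K : ℕ} (arm : ℕ → Fin K) (rew : ℕ → ℝ) (i : Fin K) (t : ℕ) : ℝ :=
  (∑ s ∈ (Finset.range t).filter (fun s => arm s = i), rew s) / (plays arm i t : ℝ)

/-- The average reward aggregated over the set `N` of arms. -/
def aggAvg {K : ℕ} (arm : ℕ → Fin K) (rew : ℕ → ℝ) (N : Finset (Fin K)) (t : ℕ) : ℝ :=
  (∑ j ∈ N, avg arm rew j t * (plays arm j t : ℝ)) / ∑ j ∈ N, (plays arm j t : ℝ)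

/-- The single-arm UCB index; an arm that has not been played has index `∞`. -/
def armIndex {K : ℕ} (arm : ℕ → Fin K) (rew : ℕ → ℝ) (i : Fin K) (t : ℕ) : EReal :=
  if plays arm i t = 0 then ⊤
  else ((avg arm rew i t + Real.sqrt (2 * Real.log t / (plays arm i t : ℝ)) : ℝ) : EReal)

/-! ### The policy LSDT-PSI -/

/-- The accuracy of epoch `m`. -/
def gapEst (m : ℕ) : ℝ := (1 / 2) ^ m

/-- The index of the last epoch; a negative value is read as `0`. -/
def lastEpoch (ε lam : ℝ) (T : ℕ) : ℕ :=
  min ⌈Real.logb 2 (8 / (Real.sqrt (2 * lam) * ε))⌉₊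
    ⌊(1 / 2) * Real.logb 2 ((T : ℝ) / Real.exp 1)⌋₊

/-- The number of plays up to which arm `i` is played in epoch `m`. -/
def target {K : ℕ} (lam : ℝ) (T : ℕ) (z : Fin K → ℝ) (m : ℕ) (i : Fin K) : ℕ :=
  ⌈lam * z i * Real.log (T * gapEst m ^ 2) / gapEst m ^ 2⌉₊

/-- The confidence radius in epoch `m`, with the observations aggregated over the set `N`. -/
def radius {K : ℕ} (T : ℕ) (arm : ℕ → Fin K) (m : ℕ) (N : Finset (Fin K)) (t : ℕ) : ℝ :=
  Real.sqrt (Real.log (T * gapEst m ^ 2) / (2 * ∑ j ∈ N, (plays arm j t : ℝ)))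

open Classical in
/-- The arms that are played in an epoch with set `B` of non-eliminated arms: the arms of `B₀` with
a non-eliminated arm in their closed neighbourhood. -/
def activeArms {K : ℕ} (ES ED : Finset (Sym2 (Fin K))) (B : Finset (Fin K)) : Finset (Fin K) :=
  (remaining ES ED).filter fun i => (simNbhd ES ED i ∩ B).Nonempty

/-- Elimination criterion at the end `t` of epoch `m` with set `B` of non-eliminated arms; the
comparison is with the largest lower confidence bound in `B`. -/
def Eliminated {K : ℕ} (ε : ℝ) (T : ℕ) (ES ED : Finset (Sym2 (Fin K)))
    (arm : ℕ → Fin K) (rew : ℕ → ℝ) (m : ℕ) (B : Finset (Fin K)) (t : ℕ) (i : Fin K) : Prop :=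
  ∃ k ∈ B,
    aggAvg arm rew (simNbhd ES ED i) t + radius T arm m (simNbhd ES ED i) t + ε ≤
      aggAvg arm rew (simNbhd ES ED k) t - radius T arm m (simNbhd ES ED k) t

open Classical in
/-- The first round of epoch `m` and the set `B_m` of arms not eliminated before it. If only one
arm is left, it is played until the end, so that neither component changes any more. Otherwise
every active arm is played up to its target, which takes as many rounds as plays are missing. -/
def epoch {K : ℕ} (ε lam : ℝ) (T : ℕ) (ES ED : Finset (Sym2 (Fin K))) (z : Fin K → ℝ)
    (arm : ℕ → Fin K) (rew : ℕ → ℝ) : ℕ → ℕ × Finset (Fin K)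
  | 0 => (0, remaining ES ED)
  | m + 1 =>
    let t := (epoch ε lam T ES ED z arm rew m).1
    let B := (epoch ε lam T ES ED z arm rew m).2
    if B.card = 1 then (t, B)
    else
      let t' := t + ∑ i ∈ activeArms ES ED B, (target lam T z m i - plays arm i t)
      (t', B.filter fun i => ¬ Eliminated ε T ES ED arm rew m B t' i)

/-- The choice of `arm t` in round `t` is one that LSDT-PSI can make, given the earlier rounds. The
order of the plays within an epoch and the breaking of ties are left open. -/
structure StepOK {K : ℕ} (ε lam : ℝ) (T : ℕ) (ES ED : Finset (Sym2 (Fin K))) (z : Fin K → ℝ)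
    (arm : ℕ → Fin K) (rew : ℕ → ℝ) (t : ℕ) : Prop where
  /-- A single remaining arm is played until the end. -/
  single : ∀ m ≤ lastEpoch ε lam T,
    (epoch ε lam T ES ED z arm rew m).2.card = 1 →
    (epoch ε lam T ES ED z arm rew m).1 ≤ t →
    arm t ∈ (epoch ε lam T ES ED z arm rew m).2
  /-- During an epoch, an active arm that has not reached its target is played. -/
  explore : ∀ m ≤ lastEpoch ε lam T,
    (epoch ε lam T ES ED z arm rew m).2.card ≠ 1 →
    (epoch ε lam T ES ED z arm rew m).1 ≤ t →
    t < (epoch ε lam T ES ED z arm rew (m + 1)).1 →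
    arm t ∈ activeArms ES ED (epoch ε lam T ES ED z arm rew m).2 ∧
      plays arm (arm t) t < target lam T z m (arm t)
  /-- After the last epoch, a remaining arm of maximal index is played. -/
  ucb : (epoch ε lam T ES ED z arm rew (lastEpoch ε lam T + 1)).1 ≤ t →
    arm t ∈ (epoch ε lam T ES ED z arm rew (lastEpoch ε lam T + 1)).2 ∧
      ∀ j ∈ (epoch ε lam T ES ED z arm rew (lastEpoch ε lam T + 1)).2,
        armIndex arm rew j t ≤ armIndex arm rew (arm t) t

/-- A selection rule: the arm for round `t` as a function of the arms played and the rewards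
observed in the rounds before `t`. -/
abbrev Policy (K : ℕ) : Type := (t : ℕ) → (Fin t → Fin K × ℝ) → Fin K

/-- The history of the first `t` rounds under the policy `π`, if playing arm `i` in round `s` yields
the reward `x s i`. -/
def history {K : ℕ} (π : Policy K) (x : ℕ → Fin K → ℝ) : (t : ℕ) → (Fin t → Fin K × ℝ)
  | 0 => Fin.elim0
  | t + 1 => Fin.snoc (α := fun _ => Fin K × ℝ) (history π x t)
      (π t (history π x t), x t (π t (history π x t)))

/-- The arm played in round `t`. -/
def armAt {K : ℕ} (π : Policy K) (x : ℕ → Fin K → ℝ) (t : ℕ) : Fin K := π t (history π x t)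

/-- The reward observed in round `t`. -/
def rewAt {K : ℕ} (π : Policy K) (x : ℕ → Fin K → ℝ) (t : ℕ) : ℝ := x t (armAt π x t)

/-- `π` is the policy LSDT-PSI with horizon `T`, input parameter `lam` and side information
`ES`, `ED`, for some optimal solution `z` of the linear program, some order of the plays within the
epochs and some breaking of ties. -/
structure IsLSDTPSI {K : ℕ} (ε lam : ℝ) (T : ℕ) (ES ED : Finset (Sym2 (Fin K)))
    (π : Policy K) : Prop where
  measurable : ∀ t, Measurable (π t)
  follows : ∃ z, IsExplorationValue ES ED z ∧
    ∀ x : ℕ → Fin K → ℝ, ∀ t < T, StepOK ε lam T ES ED z (armAt π x) (rewAt π x) t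

/-- The regret up to time `T` of the policy `π`: the expected loss against always playing an arm of
mean `μmax`, where `X t ω i` is the reward that playing arm `i` in round `t` yields. -/
def regret {K : ℕ} {Ω : Type*} [MeasurableSpace Ω] (P : Measure Ω) (X : ℕ → Ω → Fin K → ℝ)
    (μmax : ℝ) (π : Policy K) (T : ℕ) : ℝ :=
  ∫ ω, (∑ _t ∈ Finset.range T, μmax - ∑ t ∈ Finset.range T, rewAt π (fun s => X s ω) t) ∂P

end

end LSDT

/-! Fix the side information first. The loss is then charged to three sources. Exploration lasts at
most as many rounds as the sum of the last targets, which is of order `log T` times the value of the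
linear program, plus rounding. If all aggregated averages stay within their radii, a best arm is
never eliminated, while every arm with gap above `4ε` is (`Admissible.max_survives`,
`Admissible.bad_eliminated`); a failure has probability of order `1/T`, so it costs a constant. In
the index phase the usual UCB argument (`plays_le_of_index_le`) leaves order `log T` plays, up to
rare deviations, for every suboptimal arm still present. Such an arm is not in the lowest class,
whose gaps exceed `4ε`: it is in the highest class, or it is an intermediate arm that the offline
step missed.

What must be averaged over the side information is therefore a pair of counts. First, an
intermediate arm forms disjoint triples with the arms of a lower and a higher class that are not
connected. Each triple is fully revealed with probability `pS ^ 2 * pD`, and there are at least `κ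
log K` of them, so the arm survives with probability at most `K⁻²`; the expected number of such
survivors is at most `1` (`exp_midRemaining_le`). Second, the lowest and highest classes survive
entirely. A class of `n` arms is a clique, and its revealed edges form a random graph of density
`pS`. The uniform weight `4 / (pS n)` covers every arm of typical degree, and the expected number of
the others is at most `4 / pS` (`subsetExp_lowDegree_le`). Hence the value of the linear program has
expectation at most `1 + 16 / pS`.

The accuracy of the last epoch depends on `ε`, but connectedness forces `ε` to be at least the lower
bound on the positive gaps (`le_eps_of_connected`), so `ε` drops out of the constant. The remaining
instance-dependent terms do not grow with `T` and are absorbed by `log T`.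

The deviations of adaptively sampled rewards are controlled by an exponential supermartingale
(`lintegral_expDev_le`) restricted to the first `n` rewards from a set of arms. It yields
Hoeffding's bound with a deterministic `n` (`measure_devSum_ge_le`). -/

namespace LSDT

noncomputable section

/-! ### Rewards and predictable functions of them -/

/-- Rewards that are independent over time, integrable with means `μ`, and sub-Gaussian. -/
structure IsRewards {K : ℕ} {Ω : Type*} [MeasurableSpace Ω] (P : Measure Ω)
    (X : ℕ → Ω → Fin K → ℝ) (μ : Fin K → ℝ) : Prop where
  measurable : ∀ t, Measurable (X t)
  indep : iIndepFun X P
  integrable : ∀ t i, Integrable (fun ω => X t ω i) P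
  mean : ∀ t i, ∫ ω, X t ω i ∂P = μ i
  subG : ∀ t i, HasSubgaussianMGF (fun ω => X t ω i - μ i) (1 / 4) P

/-- Only the marginal law of each arm enters, so the rewards of different arms in the same round may
depend on each other. -/
theorem IsRewards.of_map {K : ℕ} {Ω : Type*} [MeasurableSpace Ω] {P : Measure Ω}
    [IsProbabilityMeasure P] {X : ℕ → Ω → Fin K → ℝ} {μ : Fin K → ℝ} {f : Fin K → Measure ℝ}
    (hmean : ∀ i, ∫ x, x ∂(f i) = μ i)
    (hsub : ∀ i, HasSubgaussianMGF (fun x => x - μ i) (1 / 4) (f i))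
    (hX : ∀ t, Measurable (X t)) (hind : iIndepFun X P)
    (hmap : ∀ t i, P.map (fun ω => X t ω i) = f i) : IsRewards P X μ := by
  have hm : ∀ t i, Measurable (fun ω => X t ω i) := fun t i =>
    (measurable_pi_apply i).comp (hX t)
  have hs : ∀ t i, HasSubgaussianMGF (fun ω => X t ω i - μ i) (1 / 4) P := by
    intro t i
    have h := hsub i
    rw [← hmap t i] at h
    exact h.of_map (hm t i).aemeasurable
  refine ⟨hX, hind, fun t i => ?_, fun t i => ?_, hs⟩
  · have := (hs t i).integrable.add (integrable_const (μ i))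
    refine this.congr (Eventually.of_forall fun ω => ?_)
    simp
  · rw [← hmean i, ← hmap t i, integral_map (hm t i).aemeasurable]
    exact aestronglyMeasurable_id

/-- A measurable function of the rewards of the rounds before `t`. -/
def Predictable {K : ℕ} {β : Type*} [MeasurableSpace β] (t : ℕ) (F : (ℕ → Fin K → ℝ) → β) :
    Prop :=
  Measurable F ∧ ∀ x y, (∀ s < t, x s = y s) → F x = F y

section
variable {K : ℕ} {Ω : Type*} [MeasurableSpace Ω] {P : Measure Ω} {X : ℕ → Ω → Fin K → ℝ}
  {μ : Fin K → ℝ} {β : Type*} [MeasurableSpace β]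

theorem IsRewards.measurable_path (h : IsRewards P X μ) :
    Measurable (fun ω => (fun s => X s ω : ℕ → Fin K → ℝ)) :=
  measurable_pi_lambda _ fun s => h.measurable s

/-- A function of the past factors through finitely many rewards, the other coordinates being filled
with zeros; independence over time then applies. -/
theorem Predictable.indepFun (h : IsRewards P X μ) {t : ℕ} {F : (ℕ → Fin K → ℝ) → β}
    (hF : Predictable t F) : IndepFun (fun ω => F (fun s => X s ω)) (X t) P := by
  have h1 := h.indep.indepFun_finset (Finset.range t) {t} (by simp) h.measurable
  let ext : ((i : Finset.range t) → (Fin K → ℝ)) → ℕ → Fin K → ℝ :=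
    fun y s => if hs : s ∈ Finset.range t then y ⟨s, hs⟩ else 0
  have hext : Measurable ext := by
    refine measurable_pi_lambda _ fun s => ?_
    by_cases hs : s ∈ Finset.range t
    · simp only [ext, hs, dif_pos]
      exact measurable_pi_apply _
    · simp only [ext, hs, dif_neg, not_false_eq_true]
      exact measurable_const
  have h2 := h1.comp (hF.1.comp hext)
    (measurable_pi_apply (⟨t, by simp⟩ : ({t} : Finset ℕ)))
  refine h2.congr (Eventually.of_forall fun ω => ?_) (Eventually.of_forall fun ω => rfl)
  refine hF.2 _ _ fun s hs => ?_
  simp [ext, hs]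

theorem history_congr (π : Policy K) {x y : ℕ → Fin K → ℝ} :
    ∀ {t : ℕ}, (∀ s < t, x s = y s) → history π x t = history π y t
  | 0, _ => rfl
  | t + 1, h => by
    have h1 : history π x t = history π y t := history_congr π fun s hs => h s (by omega)
    simp only [history, h1, h t (by omega)]

theorem measurable_eval_arm : Measurable (fun p : Fin K × (Fin K → ℝ) => p.2 p.1) := by
  refine measurable_from_prod_countable_right fun i => ?_
  exact measurable_pi_apply i

theorem measurable_history {π : Policy K} (hπ : ∀ t, Measurable (π t)) :
    ∀ t, Measurable (fun x : ℕ → Fin K → ℝ => history π x t)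
  | 0 => measurable_pi_lambda _ fun i => i.elim0
  | t + 1 => by
    have ih := measurable_history hπ t
    refine measurable_pi_lambda _ fun i => ?_
    refine Fin.lastCases ?_ (fun j => ?_) i
    · simp only [history, Fin.snoc_last]
      have h1 : Measurable (fun x : ℕ → Fin K → ℝ => π t (history π x t)) := (hπ t).comp ih
      exact h1.prodMk (measurable_eval_arm.comp (h1.prodMk (measurable_pi_apply t)))
    · simp only [history, Fin.snoc_castSucc]
      exact (measurable_pi_apply j).comp ih

theorem predictable_armAt {π : Policy K} (hπ : ∀ t, Measurable (π t)) (t : ℕ) :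
    Predictable t (fun x : ℕ → Fin K → ℝ => armAt π x t) :=
  ⟨(hπ t).comp (measurable_history hπ t), fun x y h => by
    simp only [armAt, history_congr π h]⟩

theorem armAt_congr (π : Policy K) {t : ℕ} {x y : ℕ → Fin K → ℝ} (h : ∀ s < t, x s = y s) :
    armAt π x t = armAt π y t := by
  simp only [armAt, history_congr π h]

theorem measurable_rewAt {π : Policy K} (hπ : ∀ t, Measurable (π t)) (t : ℕ) :
    Measurable (fun x : ℕ → Fin K → ℝ => rewAt π x t) :=
  measurable_eval_arm.comp ((predictable_armAt hπ t).1.prodMk (measurable_pi_apply t))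

/-! ### Regret as a sum of gaps -/

theorem rewAt_eq_sum (π : Policy K) (x : ℕ → Fin K → ℝ) (t : ℕ) :
    rewAt π x t = ∑ i, (if armAt π x t = i then 1 else 0) * x t i := by
  simp [rewAt]

theorem measurable_armAt_ind {π : Policy K} (hπ : ∀ t, Measurable (π t)) (t : ℕ) (i : Fin K) :
    Measurable (fun x : ℕ → Fin K → ℝ => if armAt π x t = i then (1 : ℝ) else 0) :=
  Measurable.ite ((predictable_armAt hπ t).1 (measurableSet_singleton i)) measurable_const
    measurable_const

theorem integrable_armAt_mul [IsProbabilityMeasure P] (h : IsRewards P X μ) {π : Policy K}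
    (hπ : ∀ t, Measurable (π t)) (t : ℕ) (i : Fin K) :
    Integrable (fun ω => (if armAt π (fun s => X s ω) t = i then (1 : ℝ) else 0) * X t ω i) P := by
  refine (h.integrable t i).mono ?_ (Eventually.of_forall fun ω => ?_)
  · exact (((measurable_armAt_ind hπ t i).comp h.measurable_path).mul
      ((measurable_pi_apply i).comp (h.measurable t))).aestronglyMeasurable
  · split_ifs <;> simp

/-- Whether arm `i` is played is decided before the reward of the round is drawn, so the reward can
be replaced by its mean. -/
theorem integral_armAt_mul [IsProbabilityMeasure P] (h : IsRewards P X μ) {π : Policy K}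
    (hπ : ∀ t, Measurable (π t)) (t : ℕ) (i : Fin K) :
    ∫ ω, (if armAt π (fun s => X s ω) t = i then (1 : ℝ) else 0) * X t ω i ∂P =
      ∫ ω, (if armAt π (fun s => X s ω) t = i then (1 : ℝ) else 0) * μ i ∂P := by
  have hpred : Predictable t
      (fun x : ℕ → Fin K → ℝ => if armAt π x t = i then (1 : ℝ) else 0) :=
    ⟨measurable_armAt_ind hπ t i, fun x y hxy => by
      simp only [armAt_congr π hxy]⟩
  have hi := hpred.indepFun h
  have := hi.integral_fun_comp_mul_comp (f := id) (g := fun v => v i)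
    ((measurable_armAt_ind hπ t i).comp h.measurable_path).aemeasurable
    (h.measurable t).aemeasurable measurable_id.aestronglyMeasurable
    (measurable_pi_apply i).aestronglyMeasurable
  simp only [id] at this
  rw [this, h.mean, integral_mul_const]

theorem regret_eq [IsProbabilityMeasure P] (h : IsRewards P X μ) {π : Policy K}
    (hπ : ∀ t, Measurable (π t)) (μmax : ℝ) (T : ℕ) :
    regret P X μmax π T =
      ∫ ω, ∑ t ∈ Finset.range T, (μmax - μ (armAt π (fun s => X s ω) t)) ∂P := by
  have hint : ∀ t, Integrable (fun ω => rewAt π (fun s => X s ω) t) P := fun t => by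
    simp only [rewAt_eq_sum]
    exact integrable_finsetSum _ fun i _ => integrable_armAt_mul h hπ t i
  have hintμ : ∀ t i, Integrable
      (fun ω => (if armAt π (fun s => X s ω) t = i then (1 : ℝ) else 0) * μ i) P := fun t i => by
    refine Integrable.mul_const ?_ _
    refine (integrable_const (1 : ℝ)).mono
      ((measurable_armAt_ind hπ t i).comp h.measurable_path).aestronglyMeasurable
      (Eventually.of_forall fun ω => ?_)
    split_ifs <;> simp
  have hμ : ∀ t ω, μ (armAt π (fun s => X s ω) t) =
      ∑ i, (if armAt π (fun s => X s ω) t = i then (1 : ℝ) else 0) * μ i := by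
    intro t ω; simp
  have hintarm : ∀ t, Integrable (fun ω => μ (armAt π (fun s => X s ω) t)) P := fun t => by
    simp only [hμ]
    exact integrable_finsetSum _ fun i _ => hintμ t i
  have hE : ∀ t, ∫ ω, rewAt π (fun s => X s ω) t ∂P =
      ∫ ω, μ (armAt π (fun s => X s ω) t) ∂P := fun t => by
    simp only [rewAt_eq_sum, hμ]
    rw [integral_finsetSum _ fun i _ => integrable_armAt_mul h hπ t i,
      integral_finsetSum _ fun i _ => hintμ t i]
    exact Finset.sum_congr rfl fun i _ => integral_armAt_mul h hπ t i
  unfold regret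
  simp only [Finset.sum_sub_distrib]
  rw [integral_sub (integrable_const _) (integrable_finsetSum _ fun t _ => hint t),
    integral_sub (integrable_const _) (integrable_finsetSum _ fun t _ => hintarm t),
    integral_finsetSum _ fun t _ => hint t, integral_finsetSum _ fun t _ => hintarm t]
  simp only [hE]

/-! ### Concentration of the first rewards of a set of arms -/

/-- The number of plays of arms of `N` during the first `t` rounds. -/
def setPlays (arm : ℕ → Fin K) (N : Finset (Fin K)) (t : ℕ) : ℕ :=
  ((Finset.range t).filter fun s => arm s ∈ N).card

/-- The sum of the deviations `rew s - μ (arm s)` over the first `n` plays of arms of `N`, as far as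
they take place during the first `t` rounds. -/
def devSum (μ : Fin K → ℝ) (arm : ℕ → Fin K) (rew : ℕ → ℝ) (N : Finset (Fin K)) (n t : ℕ) : ℝ :=
  ∑ s ∈ Finset.range t, if arm s ∈ N ∧ setPlays arm N s < n then rew s - μ (arm s) else 0

theorem setPlays_succ (arm : ℕ → Fin K) (N : Finset (Fin K)) (t : ℕ) :
    setPlays arm N (t + 1) = setPlays arm N t + if arm t ∈ N then 1 else 0 := by
  unfold setPlays
  rw [Finset.range_add_one, Finset.filter_insert]
  split_ifs with h
  · rw [Finset.card_insert_of_notMem (by simp)]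
  · simp

theorem setPlays_mono (arm : ℕ → Fin K) (N : Finset (Fin K)) : Monotone (setPlays arm N) :=
  monotone_nat_of_le_succ fun t => by rw [setPlays_succ]; omega

/-- The truncated sum is frozen once `n` plays have occurred. A tail bound at the fixed time `T`
thus applies at the random time when the count equals `n`. -/
theorem devSum_eq (μ : Fin K → ℝ) (arm : ℕ → Fin K) (rew : ℕ → ℝ) (N : Finset (Fin K))
    {n t T : ℕ} (htT : t ≤ T) (hn : setPlays arm N t = n) :
    devSum μ arm rew N n T =
      ∑ s ∈ (Finset.range t).filter (fun s => arm s ∈ N), (rew s - μ (arm s)) := by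
  unfold devSum
  rw [← Finset.sum_filter]
  congr 1
  ext s
  simp only [Finset.mem_filter, Finset.mem_range]
  constructor
  · rintro ⟨_, h1, h2⟩
    refine ⟨?_, h1⟩
    by_contra hc
    have := setPlays_mono arm N (not_lt.1 hc)
    omega
  · rintro ⟨h1, h2⟩
    refine ⟨by omega, h2, ?_⟩
    have := setPlays_mono arm N (Nat.succ_le_of_lt h1)
    rw [Nat.succ_eq_add_one, setPlays_succ, if_pos h2] at this
    omega

theorem measurable_setPlays {π : Policy K} (hπ : ∀ t, Measurable (π t)) (N : Finset (Fin K)) :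
    ∀ t, Predictable t (fun x : ℕ → Fin K → ℝ => setPlays (armAt π x) N t)
  | 0 => ⟨by simp [setPlays], fun _ _ _ => by simp [setPlays]⟩
  | t + 1 => by
    have ih := measurable_setPlays hπ N t
    have ha := predictable_armAt hπ t
    constructor
    · simp only [setPlays_succ]
      refine ih.1.add (Measurable.ite (ha.1 ?_) measurable_const measurable_const)
      exact N.measurableSet
    · intro x y hxy
      simp only [setPlays_succ]
      have h1 := ih.2 x y fun s hs => hxy s (by omega)
      simp only at h1
      rw [h1, armAt_congr π fun s hs => hxy s (by omega)]

/-- The event that the reward of round `t` is one of the first `n` rewards from `N`. -/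
def Counts (π : Policy K) (N : Finset (Fin K)) (n t : ℕ) (x : ℕ → Fin K → ℝ) : Prop :=
  armAt π x t ∈ N ∧ setPlays (armAt π x) N t < n

theorem counts_congr {π : Policy K} (hπ : ∀ t, Measurable (π t)) (N : Finset (Fin K)) (n t : ℕ)
    {x y : ℕ → Fin K → ℝ} (h : ∀ s < t, x s = y s) : Counts π N n t x ↔ Counts π N n t y := by
  unfold Counts
  have h1 := (measurable_setPlays hπ N t).2 x y h
  simp only at h1
  rw [h1, armAt_congr π h]

theorem measurableSet_counts {π : Policy K} (hπ : ∀ t, Measurable (π t)) (N : Finset (Fin K))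
    (n t : ℕ) : MeasurableSet {x | Counts π N n t x} :=
  ((predictable_armAt hπ t).1 N.measurableSet).inter
    ((measurable_setPlays hπ N t).1 measurableSet_Iio)

theorem measurable_devSum {π : Policy K} (hπ : ∀ t, Measurable (π t)) (N : Finset (Fin K))
    (n t : ℕ) : Measurable (fun x : ℕ → Fin K → ℝ =>
      devSum μ (armAt π x) (rewAt π x) N n t) := by
  unfold devSum
  refine Finset.measurable_sum _ fun s _ => ?_
  refine Measurable.ite (measurableSet_counts hπ N n s) ?_ measurable_const
  exact (measurable_rewAt hπ s).sub
    ((measurable_from_top (f := μ)).comp (predictable_armAt hπ s).1)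

theorem devSum_congr {π : Policy K} (hπ : ∀ t, Measurable (π t)) (N : Finset (Fin K))
    (n t : ℕ) {x y : ℕ → Fin K → ℝ} (h : ∀ s < t, x s = y s) :
    devSum μ (armAt π x) (rewAt π x) N n t = devSum μ (armAt π y) (rewAt π y) N n t := by
  unfold devSum
  refine Finset.sum_congr rfl fun s hs => ?_
  have hs' : s < t := Finset.mem_range.1 hs
  have h' : ∀ u < s, x u = y u := fun u hu => h u (by omega)
  have h1 := (predictable_armAt hπ s).2 x y h'
  have h2 := (measurable_setPlays hπ N s).2 x y h'
  simp only at h1 h2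
  simp only [rewAt, h1, h2, h s hs']

/-- The number of the first `n` plays of arms of `N` that take place in the first `t` rounds. -/
def devCount (arm : ℕ → Fin K) (N : Finset (Fin K)) (n t : ℕ) : ℕ :=
  ∑ s ∈ Finset.range t, if arm s ∈ N ∧ setPlays arm N s < n then 1 else 0

/-- The truncation keeps the compensator of `expDev` below its value for `n` rewards. -/
theorem devCount_eq (arm : ℕ → Fin K) (N : Finset (Fin K)) (n : ℕ) :
    ∀ t, devCount arm N n t = min n (setPlays arm N t)
  | 0 => by simp [devCount, setPlays]
  | t + 1 => by
    have ih := devCount_eq arm N n t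
    unfold devCount at ih ⊢
    rw [Finset.sum_range_succ, ih, setPlays_succ]
    by_cases h1 : arm t ∈ N <;> by_cases h2 : setPlays arm N t < n <;> simp [h1, h2] <;> omega

theorem measurable_devCount {π : Policy K} (hπ : ∀ t, Measurable (π t)) (N : Finset (Fin K))
    (n t : ℕ) : Predictable t (fun x : ℕ → Fin K → ℝ => devCount (armAt π x) N n t) := by
  simp only [devCount_eq]
  have h := measurable_setPlays hπ N t
  exact ⟨measurable_const.min h.1, fun x y hxy => by simp only [h.2 x y hxy]⟩

/-- The exponential of the deviations, compensated. -/
def expDev (μ : Fin K → ℝ) (π : Policy K) (N : Finset (Fin K)) (n : ℕ) (θ : ℝ) (t : ℕ)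
    (x : ℕ → Fin K → ℝ) : ENNReal :=
  ENNReal.ofReal (Real.exp (θ * devSum μ (armAt π x) (rewAt π x) N n t -
    θ ^ 2 / 8 * devCount (armAt π x) N n t))

theorem predictable_expDev {π : Policy K} (hπ : ∀ t, Measurable (π t)) (N : Finset (Fin K))
    (n : ℕ) (θ : ℝ) (t : ℕ) : Predictable t (expDev μ π N n θ t) := by
  constructor
  · refine ENNReal.measurable_ofReal.comp (Real.measurable_exp.comp ?_)
    refine ((measurable_devSum hπ N n t).const_mul θ).sub (Measurable.const_mul ?_ _)
    exact measurable_from_top.comp (measurable_devCount hπ N n t).1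
  · intro x y h
    have h2 := (measurable_devCount hπ N n t).2 x y h
    simp only at h2
    simp only [expDev, devSum_congr hπ N n t h, h2]

theorem lintegral_exp_reward_le (h : IsRewards P X μ) (θ : ℝ) (t : ℕ) (i : Fin K) :
    ∫⁻ ω, ENNReal.ofReal (Real.exp (θ * (X t ω i - μ i) - θ ^ 2 / 8)) ∂P ≤ 1 := by
  have hs := h.subG t i
  have h1 : Integrable (fun ω => Real.exp (θ * (X t ω i - μ i) - θ ^ 2 / 8)) P := by
    simp only [Real.exp_sub]
    exact (hs.integrable_exp_mul θ).div_const _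
  rw [← ofReal_integral_eq_lintegral_ofReal h1 (Eventually.of_forall fun ω => (Real.exp_pos _).le)]
  rw [← ENNReal.ofReal_one]
  refine ENNReal.ofReal_le_ofReal ?_
  simp only [Real.exp_sub]
  rw [integral_div, div_le_one (Real.exp_pos _)]
  refine (hs.mgf_le θ).trans (Real.exp_le_exp.2 ?_)
  push_cast
  linarith

-- Splitting by the arm played makes each summand a predictable weight times a function of the
-- rewards of round `t`, to which independence applies.
open Classical in
theorem expDev_succ (π : Policy K) (N : Finset (Fin K)) (n : ℕ) (θ : ℝ) (t : ℕ)
    (x : ℕ → Fin K → ℝ) :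
    expDev μ π N n θ (t + 1) x =
      (∑ i, (if Counts π N n t x ∧ armAt π x t = i then expDev μ π N n θ t x else 0) *
        ENNReal.ofReal (Real.exp (θ * (x t i - μ i) - θ ^ 2 / 8))) +
      if Counts π N n t x then 0 else expDev μ π N n θ t x := by
  have hsum : devSum μ (armAt π x) (rewAt π x) N n (t + 1) =
      devSum μ (armAt π x) (rewAt π x) N n t +
        if Counts π N n t x then rewAt π x t - μ (armAt π x t) else 0 := by
    unfold devSum Counts
    rw [Finset.sum_range_succ]
    congr
  have hcnt : devCount (armAt π x) N n (t + 1) =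
      devCount (armAt π x) N n t + if Counts π N n t x then 1 else 0 := by
    unfold devCount Counts
    rw [Finset.sum_range_succ]
    congr
  by_cases hc : Counts π N n t x
  · simp only [hc, true_and, if_true, add_zero, ite_mul, zero_mul, Finset.sum_ite_eq,
      Finset.mem_univ]
    unfold expDev
    rw [hsum, hcnt, if_pos hc, if_pos hc, ← ENNReal.ofReal_mul (Real.exp_pos _).le, ← Real.exp_add]
    congr 2
    simp only [rewAt]
    push_cast
    ring
  · simp only [hc, false_and, if_false, zero_mul, Finset.sum_const_zero, zero_add]
    unfold expDev
    rw [hsum, hcnt, if_neg hc, if_neg hc, add_zero, add_zero]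

-- Supermartingale property: given the past, a counted reward multiplies the process by a factor of
-- mean at most `1`, and an uncounted one leaves it unchanged. Values in `ENNReal` avoid
-- integrability questions.
open Classical in
theorem lintegral_expDev_le [IsProbabilityMeasure P] (h : IsRewards P X μ) {π : Policy K}
    (hπ : ∀ t, Measurable (π t)) (N : Finset (Fin K)) (n : ℕ) (θ : ℝ) :
    ∀ t, ∫⁻ ω, expDev μ π N n θ t (fun s => X s ω) ∂P ≤ 1
  | 0 => by simp [expDev, devSum, devCount]
  | t + 1 => by
    refine le_trans ?_ (lintegral_expDev_le h hπ N n θ t)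
    have hV := predictable_expDev (μ := μ) hπ N n θ t
    have hC := measurableSet_counts hπ N n t
    let W : Fin K → (ℕ → Fin K → ℝ) → ENNReal := fun i x =>
      if Counts π N n t x ∧ armAt π x t = i then expDev μ π N n θ t x else 0
    have hW : ∀ i, Predictable t (W i) := fun i => by
      constructor
      · exact Measurable.ite (hC.inter ((predictable_armAt hπ t).1 (measurableSet_singleton i)))
          hV.1 measurable_const
      · intro x y hxy
        have h1 := (predictable_armAt hπ t).2 x y hxy
        simp only at h1
        simp only [W, counts_congr hπ N n t hxy, h1, hV.2 x y hxy]
    have hg : ∀ i : Fin K, Measurable (fun v : Fin K → ℝ =>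
        ENNReal.ofReal (Real.exp (θ * (v i - μ i) - θ ^ 2 / 8))) := fun i => by fun_prop
    have hWm : ∀ i, Measurable (fun ω => W i (fun s => X s ω)) := fun i =>
      (hW i).1.comp h.measurable_path
    have hprod : ∀ i, ∫⁻ ω, W i (fun s => X s ω) *
        ENNReal.ofReal (Real.exp (θ * (X t ω i - μ i) - θ ^ 2 / 8)) ∂P ≤
        ∫⁻ ω, W i (fun s => X s ω) ∂P := fun i => by
      have hi := ((hW i).indepFun h).comp measurable_id (hg i)
      have := lintegral_mul_eq_lintegral_mul_lintegral_of_indepFun (hWm i)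
        ((hg i).comp (h.measurable t)) hi
      calc _ = _ := this
        _ ≤ (∫⁻ ω, W i (fun s => X s ω) ∂P) * 1 :=
            mul_le_mul_right (lintegral_exp_reward_le h θ t i) _
        _ = _ := mul_one _
    calc ∫⁻ ω, expDev μ π N n θ (t + 1) (fun s => X s ω) ∂P
        = (∑ i, ∫⁻ ω, W i (fun s => X s ω) *
            ENNReal.ofReal (Real.exp (θ * (X t ω i - μ i) - θ ^ 2 / 8)) ∂P) +
          ∫⁻ ω, (if Counts π N n t (fun s => X s ω) then 0
            else expDev μ π N n θ t (fun s => X s ω)) ∂P := by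
          simp only [expDev_succ]
          rw [lintegral_add_left, lintegral_finsetSum]
          · exact fun i _ => (hWm i).mul ((hg i).comp (h.measurable t))
          · exact Finset.measurable_sum _ fun i _ => (hWm i).mul ((hg i).comp (h.measurable t))
      _ ≤ (∑ i, ∫⁻ ω, W i (fun s => X s ω) ∂P) +
          ∫⁻ ω, (if Counts π N n t (fun s => X s ω) then 0
            else expDev μ π N n θ t (fun s => X s ω)) ∂P :=
          add_le_add_left (Finset.sum_le_sum fun i _ => hprod i) _
      _ = ∫⁻ ω, expDev μ π N n θ t (fun s => X s ω) ∂P := by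
          rw [← lintegral_finsetSum _ fun i _ => hWm i, ← lintegral_add_left]
          · refine lintegral_congr fun ω => ?_
            by_cases hc : Counts π N n t (fun s => X s ω) <;> simp [W, hc]
          · exact Finset.measurable_sum _ fun i _ => hWm i

/-- Markov's inequality for `expDev`. The sign `σ` is `1` or `-1` and treats both tails at once. -/
theorem measure_devSum_ge_le [IsProbabilityMeasure P] (h : IsRewards P X μ) {π : Policy K}
    (hπ : ∀ t, Measurable (π t)) (N : Finset (Fin K)) {n : ℕ} (hn : 0 < n) (t : ℕ) {a : ℝ}
    (ha : 0 ≤ a) (σ : ℝ) (hσ : σ ^ 2 = 1) :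
    P.real {ω | a ≤ σ * devSum μ (armAt π fun s => X s ω) (rewAt π fun s => X s ω) N n t} ≤
      Real.exp (-(2 * a ^ 2 / n)) := by
  have hn' : (0 : ℝ) < n := by exact_mod_cast hn
  -- This maximizes `θ σ a - θ ^ 2 n / 8`, with maximum `2 a ^ 2 / n`.
  set θ : ℝ := σ * (4 * a / n) with hθ
  have h1 := lintegral_expDev_le h hπ N n θ t
  have hmeas : Measurable (fun ω => expDev μ π N n θ t (fun s => X s ω)) :=
    (predictable_expDev hπ N n θ t).1.comp h.measurable_path
  have h2 := mul_meas_ge_le_lintegral (μ := P) hmeas (ENNReal.ofReal (Real.exp (2 * a ^ 2 / n)))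
  have h3 : {ω | a ≤ σ * devSum μ (armAt π fun s => X s ω) (rewAt π fun s => X s ω) N n t} ⊆
      {ω | ENNReal.ofReal (Real.exp (2 * a ^ 2 / n)) ≤
        expDev μ π N n θ t (fun s => X s ω)} := by
    intro ω hω
    simp only [Set.mem_ofPred_eq] at hω ⊢
    refine ENNReal.ofReal_le_ofReal (Real.exp_le_exp.2 ?_)
    have hc : (devCount (armAt π fun s => X s ω) N n t : ℝ) ≤ n := by
      rw [devCount_eq]; exact_mod_cast min_le_left _ _
    have e1 : θ * devSum μ (armAt π fun s => X s ω) (rewAt π fun s => X s ω) N n t =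
      (4 * a / n) * (σ * devSum μ (armAt π fun s => X s ω) (rewAt π fun s => X s ω) N n t) := by
      rw [hθ]; ring
    have e2 : (4 * a / n) * a ≤ (4 * a / n) *
        (σ * devSum μ (armAt π fun s => X s ω) (rewAt π fun s => X s ω) N n t) :=
      mul_le_mul_of_nonneg_left hω (by positivity)
    have e3 : θ ^ 2 / 8 * devCount (armAt π fun s => X s ω) N n t ≤ θ ^ 2 / 8 * n :=
      mul_le_mul_of_nonneg_left hc (by positivity)
    have e4 : θ ^ 2 / 8 * n = 2 * a ^ 2 / n := by
      rw [hθ, mul_pow, hσ]; field_simp; ring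
    have e5 : (4 * a / n) * a = 2 * a ^ 2 / n + 2 * a ^ 2 / n := by field_simp; ring
    rw [e1]; linarith
  have h4 : ENNReal.ofReal (Real.exp (2 * a ^ 2 / n)) *
      P {ω | a ≤ σ * devSum μ (armAt π fun s => X s ω) (rewAt π fun s => X s ω) N n t} ≤ 1 :=
    (mul_le_mul_right (measure_mono h3) _).trans (h2.trans h1)
  have h5 := ENNReal.toReal_mono ENNReal.one_ne_top h4
  rw [ENNReal.toReal_mul, ENNReal.toReal_ofReal (Real.exp_pos _).le, ENNReal.toReal_one] at h5
  rw [Real.exp_neg, ← one_div, le_div_iff₀ (Real.exp_pos _), mul_comm]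
  exact h5

end

/-! ### Counting plays -/

section
variable {K : ℕ}

theorem plays_eq_setPlays (arm : ℕ → Fin K) (i : Fin K) (t : ℕ) :
    plays arm i t = setPlays arm {i} t := by
  simp [plays, setPlays]

theorem plays_succ (arm : ℕ → Fin K) (i : Fin K) (t : ℕ) :
    plays arm i (t + 1) = plays arm i t + if arm t = i then 1 else 0 := by
  simp only [plays_eq_setPlays, setPlays_succ, Finset.mem_singleton]

theorem sum_plays (arm : ℕ → Fin K) (N : Finset (Fin K)) (t : ℕ) :
    ∑ i ∈ N, plays arm i t = setPlays arm N t := by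
  induction t with
  | zero => simp [plays, setPlays]
  | succ t ih =>
    simp only [plays_succ, setPlays_succ, Finset.sum_add_distrib, ih, Finset.sum_ite_eq]

theorem setPlays_univ (arm : ℕ → Fin K) (t : ℕ) : setPlays arm Finset.univ t = t := by
  simp [setPlays]

theorem setPlays_le (arm : ℕ → Fin K) (N : Finset (Fin K)) (t : ℕ) : setPlays arm N t ≤ t := by
  simpa [setPlays] using Finset.card_filter_le (Finset.range t) fun s => arm s ∈ N

/-- If only arms of `S` below their targets `g` are played, for as many rounds as plays are missing,
then all targets are met exactly. -/
theorem plays_fill (arm : ℕ → Fin K) (S : Finset (Fin K)) (g : Fin K → ℕ) (t₀ D : ℕ)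
    (hD : D = ∑ i ∈ S, (g i - plays arm i t₀))
    (hstep : ∀ t, t₀ ≤ t → t < t₀ + D → arm t ∈ S ∧ plays arm (arm t) t < g (arm t))
    (hle : ∀ i ∈ S, plays arm i t₀ ≤ g i) :
    (∀ i ∈ S, plays arm i (t₀ + D) = g i) ∧
      ∀ i ∉ S, plays arm i (t₀ + D) = plays arm i t₀ := by
  -- Each round raises the total number of plays in `S` by one, so after `D` rounds the total equals
  -- the sum of the targets. As no arm exceeds its target, equality holds arm by arm.
  have key : ∀ s ≤ D, (∀ i ∈ S, plays arm i (t₀ + s) ≤ g i) ∧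
      (∀ i ∉ S, plays arm i (t₀ + s) = plays arm i t₀) ∧
      setPlays arm S (t₀ + s) = setPlays arm S t₀ + s := by
    intro s
    induction s with
    | zero => exact fun _ => ⟨hle, fun _ _ => rfl, rfl⟩
    | succ s ih =>
      intro hs
      obtain ⟨h1, h2, h3⟩ := ih (by omega)
      obtain ⟨h4, h5⟩ := hstep (t₀ + s) (by omega) (by omega)
      refine ⟨fun i hi => ?_, fun i hi => ?_, ?_⟩
      · rw [← add_assoc, plays_succ]
        split_ifs with h
        · subst h; omega
        · exact h1 i hi
      · rw [← add_assoc, plays_succ, if_neg (fun h : arm (t₀ + s) = i => hi (h ▸ h4)), add_zero, h2 i hi]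
      · rw [← add_assoc, setPlays_succ, if_pos h4, h3]; omega
  obtain ⟨h1, h2, h3⟩ := key D le_rfl
  refine ⟨?_, h2⟩
  have hsum : ∑ i ∈ S, plays arm i (t₀ + D) = ∑ i ∈ S, g i := by
    rw [sum_plays, h3, ← sum_plays, hD, ← Finset.sum_add_distrib]
    refine Finset.sum_congr rfl fun i hi => ?_
    have := hle i hi
    omega
  exact (Finset.sum_eq_sum_iff_of_le h1).1 hsum

/-- On the rounds in which `i` is played, the number of earlier plays of `i` is injective. -/
theorem card_early_plays_le (arm : ℕ → Fin K) (i : Fin K) (u T : ℕ) :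
    ((Finset.range T).filter fun t => arm t = i ∧ plays arm i t < u).card ≤ u := by
  have : ((Finset.range T).filter fun t => arm t = i ∧ plays arm i t < u).card ≤
      (Finset.range u).card := by
    refine Finset.card_le_card_of_injOn (fun t => plays arm i t) ?_ ?_
    · intro t ht
      simp only [Finset.coe_filter, Finset.mem_range, Set.mem_ofPred_eq] at ht
      simpa using ht.2.2
    · intro s hs t ht hst
      simp only [Finset.coe_filter, Finset.mem_range, Set.mem_ofPred_eq] at hs ht
      simp only at hst
      by_contra hne
      have hlt : ∀ a b, a < b → arm a = i → plays arm i a < plays arm i b := by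
        intro a b hab ha
        have h1 : plays arm i (a + 1) ≤ plays arm i b := by
          simp only [plays_eq_setPlays]
          exact setPlays_mono arm {i} hab
        rw [plays_succ, if_pos ha] at h1
        omega
      rcases lt_or_gt_of_ne hne with h | h
      · have := hlt s t h hs.2.1; omega
      · have := hlt t s h ht.2.1; omega
  simpa using this

theorem avg_mul_plays (arm : ℕ → Fin K) (rew : ℕ → ℝ) (i : Fin K) (t : ℕ) :
    avg arm rew i t * plays arm i t =
      ∑ s ∈ (Finset.range t).filter (fun s => arm s = i), rew s := by
  unfold avg
  by_cases h : plays arm i t = 0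
  · have : (Finset.range t).filter (fun s => arm s = i) = ∅ := Finset.card_eq_zero.1 h
    simp [this]
  · rw [div_mul_cancel₀]
    exact_mod_cast h

theorem aggAvg_eq (arm : ℕ → Fin K) (rew : ℕ → ℝ) (N : Finset (Fin K)) (t : ℕ) :
    aggAvg arm rew N t =
      (∑ s ∈ (Finset.range t).filter (fun s => arm s ∈ N), rew s) / (setPlays arm N t : ℝ) := by
  unfold aggAvg
  congr 1
  · simp only [avg_mul_plays]
    rw [← Finset.sum_fiberwise_of_maps_to (s := (Finset.range t).filter (fun s => arm s ∈ N))
      (t := N) (g := arm) (fun s hs => (Finset.mem_filter.1 hs).2)]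
    refine Finset.sum_congr rfl fun i hi => ?_
    refine Finset.sum_congr ?_ fun _ _ => rfl
    ext s
    simp only [Finset.mem_filter]
    constructor
    · rintro ⟨h1, h2⟩; exact ⟨⟨h1, h2 ▸ hi⟩, h2⟩
    · rintro ⟨h1, h2⟩; exact ⟨h1.1, h2⟩
  · rw [← sum_plays]; push_cast; rfl

/-- An aggregated average lies close to the range of the means of its arms. -/
theorem aggAvg_bounds (μ : Fin K → ℝ) (arm : ℕ → Fin K) (rew : ℕ → ℝ) (N : Finset (Fin K))
    {n t T : ℕ} (htT : t ≤ T) (hn : setPlays arm N t = n) (hn0 : 0 < n) {r lo hi : ℝ}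
    (hdev : |devSum μ arm rew N n T| < n * r)
    (hlo : ∀ j ∈ N, lo ≤ μ j) (hhi : ∀ j ∈ N, μ j ≤ hi) :
    lo - r < aggAvg arm rew N t ∧ aggAvg arm rew N t < hi + r := by
  have hn' : (0 : ℝ) < n := by exact_mod_cast hn0
  rw [devSum_eq μ arm rew N htT hn, Finset.sum_sub_distrib, abs_lt] at hdev
  have h1 : (n : ℝ) * lo ≤ ∑ s ∈ (Finset.range t).filter (fun s => arm s ∈ N), μ (arm s) := by
    have := Finset.card_nsmul_le_sum ((Finset.range t).filter (fun s => arm s ∈ N))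
      (fun s => μ (arm s)) lo fun s hs => hlo _ (Finset.mem_filter.1 hs).2
    rw [← hn]; simpa [setPlays] using this
  have h2 : ∑ s ∈ (Finset.range t).filter (fun s => arm s ∈ N), μ (arm s) ≤ (n : ℝ) * hi := by
    have := Finset.sum_le_card_nsmul ((Finset.range t).filter (fun s => arm s ∈ N))
      (fun s => μ (arm s)) hi fun s hs => hhi _ (Finset.mem_filter.1 hs).2
    rw [← hn]; simpa [setPlays] using this
  rw [aggAvg_eq, hn, lt_div_iff₀ hn', div_lt_iff₀ hn']
  constructor <;> nlinarith [hdev.1, hdev.2]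

end

/-! ### The epochs of a run -/

theorem gapEst_pos (m : ℕ) : 0 < gapEst m := by unfold gapEst; positivity

theorem gapEst_anti {m m' : ℕ} (h : m ≤ m') : gapEst m' ≤ gapEst m :=
  pow_le_pow_of_le_one (by norm_num) (by norm_num) h

/-- The number of observations that are aggregated for arm `i` at the end of epoch `m`. -/
def aggTarget {K : ℕ} (lam : ℝ) (T : ℕ) (ES ED : Finset (Sym2 (Fin K))) (z : Fin K → ℝ) (m : ℕ)
    (i : Fin K) : ℕ := ∑ j ∈ simNbhd ES ED i, target lam T z m j

/-- The deviation allowed for the sum of these observations. -/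
def aggTol {K : ℕ} (lam : ℝ) (T : ℕ) (ES ED : Finset (Sym2 (Fin K))) (z : Fin K → ℝ) (m : ℕ)
    (i : Fin K) : ℝ :=
  aggTarget lam T ES ED z m i *
    Real.sqrt (Real.log (T * gapEst m ^ 2) / (2 * aggTarget lam T ES ED z m i))

/-- Side information and horizon for which the exploration phase runs to its end. -/
structure Admissible {K : ℕ} (ε lam : ℝ) (T : ℕ) (ES ED : Finset (Sym2 (Fin K)))
    (z μ : Fin K → ℝ) (imax : Fin K) : Prop where
  eps_pos : 0 < ε
  lam_pos : 0 < lam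
  sim : ∀ i j, s(i, j) ∈ ES → |μ i - μ j| < ε
  le_max : ∀ j, μ j ≤ μ imax
  feasible : LPFeasible ES ED z
  max_mem : imax ∈ remaining ES ED
  exp_le : Real.exp 1 ≤ T * gapEst (lastEpoch ε lam T) ^ 2
  acc : gapEst (lastEpoch ε lam T) / Real.sqrt (2 * lam) ≤ ε / 4
  horizon : ∑ i ∈ remaining ES ED, target lam T z (lastEpoch ε lam T) i ≤ T

section
variable {K : ℕ} {ε lam : ℝ} {T : ℕ} {ES ED : Finset (Sym2 (Fin K))} {z μ : Fin K → ℝ}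
  {imax : Fin K} {arm : ℕ → Fin K} {rew : ℕ → ℝ}

theorem Admissible.exp_le_of_le (h : Admissible ε lam T ES ED z μ imax) {m : ℕ}
    (hm : m ≤ lastEpoch ε lam T) : Real.exp 1 ≤ T * gapEst m ^ 2 := by
  refine h.exp_le.trans ?_
  have := gapEst_anti hm
  have := gapEst_pos (lastEpoch ε lam T)
  gcongr

theorem Admissible.one_le_log (h : Admissible ε lam T ES ED z μ imax) {m : ℕ}
    (hm : m ≤ lastEpoch ε lam T) : 1 ≤ Real.log (T * gapEst m ^ 2) := by
  rw [Real.le_log_iff_exp_le (lt_of_lt_of_le (Real.exp_pos 1) (h.exp_le_of_le hm))]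
  exact h.exp_le_of_le hm

/-- The function `log x / x` decreases for `x ≥ e`, and `exp_le` keeps all arguments `T * gapEst m ^
2` in that range. -/
theorem Admissible.target_mono (h : Admissible ε lam T ES ED z μ imax) {m m' : ℕ}
    (hm : m ≤ m') (hm' : m' ≤ lastEpoch ε lam T) {i : Fin K} (hi : i ∈ remaining ES ED) :
    target lam T z m i ≤ target lam T z m' i := by
  refine Nat.ceil_mono ?_
  have e1 := h.exp_le_of_le hm'
  have e2 := h.exp_le_of_le (hm.trans hm')
  have g1 := gapEst_pos m
  have g2 := gapEst_pos m'
  have hle : (T : ℝ) * gapEst m' ^ 2 ≤ T * gapEst m ^ 2 := by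
    have := gapEst_anti hm
    gcongr
  have hT : (0 : ℝ) < T := by
    by_contra hc
    have h0 : (T : ℝ) ≤ 0 := not_lt.1 hc
    have := Real.exp_pos 1
    nlinarith [sq_nonneg (gapEst m)]
  have hanti := Real.log_div_self_antitoneOn (a := T * gapEst m' ^ 2) (b := T * gapEst m ^ 2)
    e1 e2 hle
  simp only at hanti
  have key : Real.log (T * gapEst m ^ 2) / gapEst m ^ 2 ≤
      Real.log (T * gapEst m' ^ 2) / gapEst m' ^ 2 := by
    have h2 := mul_le_mul_of_nonneg_left hanti hT.le
    calc _ = T * (Real.log (T * gapEst m ^ 2) / (T * gapEst m ^ 2)) := by field_simp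
      _ ≤ _ := h2
      _ = _ := by field_simp
  rw [mul_div_assoc, mul_div_assoc]
  exact mul_le_mul_of_nonneg_left key (mul_nonneg h.lam_pos.le (h.feasible.2 i hi))

theorem simNbhd_symm {i j : Fin K} (hi : i ∈ remaining ES ED) (hj : j ∈ simNbhd ES ED i) :
    i ∈ simNbhd ES ED j := by
  unfold simNbhd at hj ⊢
  simp only [Finset.mem_filter] at hj ⊢
  refine ⟨hi, hj.2.imp Eq.symm fun h => ?_⟩
  rwa [Sym2.eq_swap]

theorem simNbhd_subset (i : Fin K) : simNbhd ES ED i ⊆ remaining ES ED :=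
  Finset.filter_subset _ _

theorem mem_activeArms {B : Finset (Fin K)} {i j : Fin K} (hi : i ∈ remaining ES ED)
    (hB : i ∈ B) (hj : j ∈ simNbhd ES ED i) : j ∈ activeArms ES ED B := by
  unfold activeArms
  rw [Finset.mem_filter]
  exact ⟨simNbhd_subset i hj, i, Finset.mem_inter.2 ⟨simNbhd_symm hi hj, hB⟩⟩

theorem Admissible.mean_near (h : Admissible ε lam T ES ED z μ imax) {i j : Fin K}
    (hj : j ∈ simNbhd ES ED i) : |μ i - μ j| < ε := by
  unfold simNbhd at hj
  simp only [Finset.mem_filter] at hj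
  rcases hj.2 with rfl | h1
  · simpa using h.eps_pos
  · exact h.sim _ _ h1

/-- The constraint of the linear program at `i` says that the exploration values over `N'[i]` sum to
at least `1`; rounding up only adds observations. -/
theorem Admissible.aggTarget_ge (h : Admissible ε lam T ES ED z μ imax) {m : ℕ}
    (hm : m ≤ lastEpoch ε lam T) {i : Fin K} (hi : i ∈ remaining ES ED) :
    lam * Real.log (T * gapEst m ^ 2) / gapEst m ^ 2 ≤ aggTarget lam T ES ED z m i := by
  have hlog := h.one_le_log hm
  have hg := gapEst_pos m
  have h1 : ∑ j ∈ simNbhd ES ED i, lam * z j * Real.log (T * gapEst m ^ 2) / gapEst m ^ 2 ≤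
      aggTarget lam T ES ED z m i := by
    unfold aggTarget
    push_cast
    exact Finset.sum_le_sum fun j _ => Nat.le_ceil _
  refine le_trans ?_ h1
  rw [← Finset.sum_div, ← Finset.sum_mul, ← Finset.mul_sum]
  have hz := h.feasible.1 i hi
  have : lam ≤ lam * ∑ j ∈ simNbhd ES ED i, z j := le_mul_of_one_le_right h.lam_pos.le hz
  gcongr

theorem Admissible.aggTarget_pos (h : Admissible ε lam T ES ED z μ imax) {m : ℕ}
    (hm : m ≤ lastEpoch ε lam T) {i : Fin K} (hi : i ∈ remaining ES ED) :
    0 < aggTarget lam T ES ED z m i := by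
  have h1 := h.aggTarget_ge hm hi
  have h2 : 0 < lam * Real.log (T * gapEst m ^ 2) / gapEst m ^ 2 := by
    have := h.one_le_log hm
    have := gapEst_pos m
    have := h.lam_pos
    positivity
  exact_mod_cast h2.trans_le h1

/-- The logarithm in the target cancels the one in the radius, which leaves a multiple of the
accuracy of the epoch. -/
theorem Admissible.radius_le (h : Admissible ε lam T ES ED z μ imax) {m : ℕ}
    (hm : m ≤ lastEpoch ε lam T) {i : Fin K} (hi : i ∈ remaining ES ED) :
    Real.sqrt (Real.log (T * gapEst m ^ 2) / (2 * aggTarget lam T ES ED z m i)) ≤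
      gapEst m / Real.sqrt (2 * lam) := by
  have h1 := h.aggTarget_ge hm hi
  have h2 := h.one_le_log hm
  have hg := gapEst_pos m
  have hl := h.lam_pos
  have hn : (0 : ℝ) < aggTarget lam T ES ED z m i := by exact_mod_cast h.aggTarget_pos hm hi
  rw [← Real.sqrt_sq hg.le, ← Real.sqrt_div (sq_nonneg _), Real.sqrt_sq hg.le]
  refine Real.sqrt_le_sqrt ?_
  rw [div_le_div_iff₀ (by positivity) (by positivity)]
  rw [div_le_iff₀ (by positivity)] at h1
  nlinarith

/-- Exploration proceeds as scheduled. -/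
theorem Admissible.epoch_inv (h : Admissible ε lam T ES ED z μ imax)
    (hOK : ∀ t < T, StepOK ε lam T ES ED z arm rew t) :
    ∀ m ≤ lastEpoch ε lam T + 1,
      (epoch ε lam T ES ED z arm rew m).2 ⊆ remaining ES ED ∧
      (epoch ε lam T ES ED z arm rew m).1 ≤ T ∧
      (∀ i ∈ remaining ES ED, ∀ m' ≤ lastEpoch ε lam T, m ≤ m' + 1 →
        plays arm i (epoch ε lam T ES ED z arm rew m).1 ≤ target lam T z m' i) ∧
      (∀ i ∉ remaining ES ED, plays arm i (epoch ε lam T ES ED z arm rew m).1 = 0) ∧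
      (∀ m', m = m' + 1 → (epoch ε lam T ES ED z arm rew m').2.card ≠ 1 →
        ∀ i ∈ activeArms ES ED (epoch ε lam T ES ED z arm rew m').2,
          plays arm i (epoch ε lam T ES ED z arm rew m).1 = target lam T z m' i) := by
  classical
  -- `StepOK` is known only before `T`, hence the bound on the start of the epoch is part of the
  -- induction. The condition `m ≤ m' + 1` covers the target of the epoch just finished and all
  -- later ones.
  intro m
  induction m with
  | zero =>
    intro _
    refine ⟨subset_rfl, Nat.zero_le _, fun i _ m' _ _ => ?_, fun i _ => ?_, fun m' hm' => ?_⟩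
    · simp [epoch, plays]
    · simp [epoch, plays]
    · omega
  | succ m ih =>
    intro hm
    obtain ⟨hB, hT, hle, hz, -⟩ := ih (by omega)
    by_cases hc : (epoch ε lam T ES ED z arm rew m).2.card = 1
    · have he : epoch ε lam T ES ED z arm rew (m + 1) = epoch ε lam T ES ED z arm rew m := by
        simp only [epoch, hc, if_true]
      rw [he]
      refine ⟨hB, hT, fun i hi m' hm' hmm' => hle i hi m' hm' (by omega), hz, ?_⟩
      intro m' hm' hc'
      have : m' = m := by omega
      subst this
      exact absurd hc hc'
    · have he : epoch ε lam T ES ED z arm rew (m + 1) =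
          ((epoch ε lam T ES ED z arm rew m).1 +
            ∑ i ∈ activeArms ES ED (epoch ε lam T ES ED z arm rew m).2,
              (target lam T z m i - plays arm i (epoch ε lam T ES ED z arm rew m).1),
            (epoch ε lam T ES ED z arm rew (m + 1)).2) := by
        conv_lhs => rw [epoch]
        simp only [hc, if_false]
        rw [Prod.mk.injEq]
        refine ⟨rfl, ?_⟩
        simp only [epoch, hc, if_false]
      have hB' : (epoch ε lam T ES ED z arm rew (m + 1)).2 ⊆ remaining ES ED := by
        simp only [epoch, hc, if_false]
        exact (Finset.filter_subset _ _).trans hB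
      have he1 : (epoch ε lam T ES ED z arm rew (m + 1)).1 = (epoch ε lam T ES ED z arm rew m).1 +
            ∑ i ∈ activeArms ES ED (epoch ε lam T ES ED z arm rew m).2,
              (target lam T z m i - plays arm i (epoch ε lam T ES ED z arm rew m).1) := by
        rw [he]
      have hact : activeArms ES ED (epoch ε lam T ES ED z arm rew m).2 ⊆ remaining ES ED :=
        Finset.filter_subset _ _
      have hleM : ∀ i ∈ remaining ES ED,
          plays arm i (epoch ε lam T ES ED z arm rew m).1 ≤ target lam T z m i :=
        fun i hi => hle i hi m (by omega) (by omega)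
      have hT' : (epoch ε lam T ES ED z arm rew (m + 1)).1 ≤ T := by
        -- All rounds so far were spent on remaining arms, so their number is the sum of the plays
        -- of these arms; after the epoch this sum is at most the sum of the targets.
        refine le_trans ?_ h.horizon
        have h1 : (epoch ε lam T ES ED z arm rew m).1 =
            ∑ i ∈ remaining ES ED, plays arm i (epoch ε lam T ES ED z arm rew m).1 := by
          rw [Finset.sum_subset (Finset.subset_univ _) fun i _ hi => hz i hi, sum_plays,
            setPlays_univ]
        have h2 : ∑ i ∈ activeArms ES ED (epoch ε lam T ES ED z arm rew m).2,
              (target lam T z m i - plays arm i (epoch ε lam T ES ED z arm rew m).1) ≤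
            ∑ i ∈ remaining ES ED,
              (target lam T z m i - plays arm i (epoch ε lam T ES ED z arm rew m).1) :=
          Finset.sum_le_sum_of_subset hact
        have h3 : ∑ i ∈ remaining ES ED, plays arm i (epoch ε lam T ES ED z arm rew m).1 +
            ∑ i ∈ remaining ES ED,
              (target lam T z m i - plays arm i (epoch ε lam T ES ED z arm rew m).1) =
            ∑ i ∈ remaining ES ED, target lam T z m i := by
          rw [← Finset.sum_add_distrib]
          refine Finset.sum_congr rfl fun i hi => ?_
          have := hleM i hi
          omega
        have h4 : ∑ i ∈ remaining ES ED, target lam T z m i ≤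
            ∑ i ∈ remaining ES ED, target lam T z (lastEpoch ε lam T) i :=
          Finset.sum_le_sum fun i hi => h.target_mono (by omega) le_rfl hi
        rw [he1]
        omega
      have hfill := plays_fill arm (activeArms ES ED (epoch ε lam T ES ED z arm rew m).2)
        (target lam T z m) (epoch ε lam T ES ED z arm rew m).1 _ rfl
        (fun t ht1 ht2 => by
          rw [← he1] at ht2
          exact (hOK t (by omega)).explore m (by omega) hc ht1 ht2)
        (fun i hi => hleM i (hact hi))
      rw [← he1] at hfill
      refine ⟨hB', hT', fun i hi m' hm' hmm' => ?_, fun i hi => ?_, fun m' hm' _ i hi => ?_⟩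
      · by_cases hia : i ∈ activeArms ES ED (epoch ε lam T ES ED z arm rew m).2
        · rw [hfill.1 i hia]
          exact h.target_mono (by omega) hm' hi
        · rw [hfill.2 i hia]
          exact hle i hi m' hm' (by omega)
      · rw [hfill.2 i fun hia => hi (hact hia)]
        exact hz i hi
      · have : m' = m := by omega
        subst this
        exact hfill.1 i hi

/-- The total number of exploration rounds. -/
theorem Admissible.epoch_le (h : Admissible ε lam T ES ED z μ imax)
    (hOK : ∀ t < T, StepOK ε lam T ES ED z arm rew t) :
    (epoch ε lam T ES ED z arm rew (lastEpoch ε lam T + 1)).1 ≤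
      ∑ i ∈ remaining ES ED, target lam T z (lastEpoch ε lam T) i := by
  obtain ⟨-, -, hle, hz, -⟩ := h.epoch_inv hOK _ le_rfl
  have h1 : (epoch ε lam T ES ED z arm rew (lastEpoch ε lam T + 1)).1 =
      ∑ i ∈ remaining ES ED,
        plays arm i (epoch ε lam T ES ED z arm rew (lastEpoch ε lam T + 1)).1 := by
    rw [Finset.sum_subset (Finset.subset_univ _) fun i _ hi => hz i hi, sum_plays, setPlays_univ]
  rw [h1]
  exact Finset.sum_le_sum fun i hi => hle i hi _ le_rfl le_rfl

/-! ### Elimination with accurate averages -/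

/-- All aggregated averages of the exploration phase are within their confidence radii. -/
def WellEstimated (lam : ℝ) (T L : ℕ) (ES ED : Finset (Sym2 (Fin K))) (z μ : Fin K → ℝ)
    (arm : ℕ → Fin K) (rew : ℕ → ℝ) : Prop :=
  ∀ m ≤ L, ∀ i ∈ remaining ES ED,
    |devSum μ arm rew (simNbhd ES ED i) (aggTarget lam T ES ED z m i) T| <
      aggTol lam T ES ED z m i

/-- While `i` is not eliminated, every arm of `N'[i]` is active and ends the epoch exactly at its
target. The number of aggregated observations is therefore the deterministic `aggTarget`, to which
`WellEstimated` refers. -/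
theorem Admissible.aggAvg_near (h : Admissible ε lam T ES ED z μ imax)
    (hOK : ∀ t < T, StepOK ε lam T ES ED z arm rew t)
    (hgood : WellEstimated lam T (lastEpoch ε lam T) ES ED z μ arm rew) {m : ℕ}
    (hm : m ≤ lastEpoch ε lam T) (hc : (epoch ε lam T ES ED z arm rew m).2.card ≠ 1)
    {i : Fin K} (hi : i ∈ (epoch ε lam T ES ED z arm rew m).2) {lo hi' : ℝ}
    (hlo : ∀ j ∈ simNbhd ES ED i, lo ≤ μ j) (hhi : ∀ j ∈ simNbhd ES ED i, μ j ≤ hi') :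
    radius T arm m (simNbhd ES ED i) (epoch ε lam T ES ED z arm rew (m + 1)).1 ≤
        gapEst m / Real.sqrt (2 * lam) ∧
    lo - radius T arm m (simNbhd ES ED i) (epoch ε lam T ES ED z arm rew (m + 1)).1 <
      aggAvg arm rew (simNbhd ES ED i) (epoch ε lam T ES ED z arm rew (m + 1)).1 ∧
    aggAvg arm rew (simNbhd ES ED i) (epoch ε lam T ES ED z arm rew (m + 1)).1 <
      hi' + radius T arm m (simNbhd ES ED i) (epoch ε lam T ES ED z arm rew (m + 1)).1 := by
  obtain ⟨hB, -, -, -, -⟩ := h.epoch_inv hOK m (by omega)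
  obtain ⟨-, hT, -, -, hfull⟩ := h.epoch_inv hOK (m + 1) (by omega)
  have hir := hB hi
  have hpl : ∀ j ∈ simNbhd ES ED i,
      plays arm j (epoch ε lam T ES ED z arm rew (m + 1)).1 = target lam T z m j := fun j hj =>
    hfull m rfl hc j (mem_activeArms hir hi hj)
  have hset : setPlays arm (simNbhd ES ED i) (epoch ε lam T ES ED z arm rew (m + 1)).1 =
      aggTarget lam T ES ED z m i := by
    rw [← sum_plays]
    exact Finset.sum_congr rfl hpl
  have hrad : radius T arm m (simNbhd ES ED i) (epoch ε lam T ES ED z arm rew (m + 1)).1 =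
      Real.sqrt (Real.log (T * gapEst m ^ 2) / (2 * aggTarget lam T ES ED z m i)) := by
    unfold radius aggTarget
    push_cast
    rw [Finset.sum_congr rfl fun j hj => by rw [hpl j hj]]
  rw [hrad]
  exact ⟨h.radius_le hm hir, aggAvg_bounds μ arm rew _ hT hset (h.aggTarget_pos hm hir)
    (hgood m hm i hir) hlo hhi⟩

/-- Aggregation lowers the average of the best arm by less than `ε` beyond its radius, and the
criterion adds `ε` back; no lower confidence bound reaches `μ imax`, since no mean exceeds it. -/
theorem Admissible.max_survives (h : Admissible ε lam T ES ED z μ imax)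
    (hOK : ∀ t < T, StepOK ε lam T ES ED z arm rew t)
    (hgood : WellEstimated lam T (lastEpoch ε lam T) ES ED z μ arm rew) :
    ∀ m ≤ lastEpoch ε lam T + 1, imax ∈ (epoch ε lam T ES ED z arm rew m).2 := by
  classical
  intro m
  induction m with
  | zero => exact fun _ => h.max_mem
  | succ m ih =>
    intro hm
    have hmem := ih (by omega)
    by_cases hc : (epoch ε lam T ES ED z arm rew m).2.card = 1
    · simpa only [epoch, hc, if_true] using hmem
    · have hnot : ¬ Eliminated ε T ES ED arm rew m (epoch ε lam T ES ED z arm rew m).2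
          (epoch ε lam T ES ED z arm rew (m + 1)).1 imax := by
        rintro ⟨k, hk, hle⟩
        obtain ⟨-, h1, -⟩ := h.aggAvg_near hOK hgood (by omega) hc hmem (lo := μ imax - ε)
          (hi' := μ imax) (fun j hj => by have := abs_lt.1 (h.mean_near hj); linarith)
          (fun j _ => h.le_max j)
        obtain ⟨-, -, h2⟩ := h.aggAvg_near hOK hgood (by omega) hc hk (lo := μ k - ε)
          (hi' := μ imax) (fun j hj => by have := abs_lt.1 (h.mean_near hj); linarith)
          (fun j _ => h.le_max j)
        linarith
      simp only [epoch, hc, if_false] at hnot ⊢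
      exact Finset.mem_filter.2 ⟨hmem, hnot⟩

/-- All radii of the last epoch are at most `ε / 4`. The left side of the criterion is then below `μ
i + 2ε + ε/2` and the right side for `imax` above `μ imax - ε - ε/2`, a difference of `4ε` in total.
-/
theorem Admissible.bad_eliminated (h : Admissible ε lam T ES ED z μ imax)
    (hOK : ∀ t < T, StepOK ε lam T ES ED z arm rew t)
    (hgood : WellEstimated lam T (lastEpoch ε lam T) ES ED z μ arm rew) {i : Fin K}
    (hi : 4 * ε < μ imax - μ i) :
    i ∉ (epoch ε lam T ES ED z arm rew (lastEpoch ε lam T + 1)).2 := by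
  classical
  intro hmem
  have hε := h.eps_pos
  have hne : i ≠ imax := fun hc => by rw [hc] at hi; linarith
  have hmax := h.max_survives hOK hgood (lastEpoch ε lam T) (by omega)
  -- A single remaining arm must be `imax`, which survives.
  by_cases hc : (epoch ε lam T ES ED z arm rew (lastEpoch ε lam T)).2.card = 1
  · simp only [epoch, hc, if_true] at hmem
    obtain ⟨a, ha⟩ := Finset.card_eq_one.1 hc
    rw [ha, Finset.mem_singleton] at hmem hmax
    exact hne (hmem.trans hmax.symm)
  · have hel : Eliminated ε T ES ED arm rew (lastEpoch ε lam T)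
        (epoch ε lam T ES ED z arm rew (lastEpoch ε lam T)).2
        (epoch ε lam T ES ED z arm rew (lastEpoch ε lam T + 1)).1 i := by
      have hi' : i ∈ (epoch ε lam T ES ED z arm rew (lastEpoch ε lam T)).2 := by
        simp only [epoch, hc, if_false] at hmem
        exact (Finset.mem_filter.1 hmem).1
      obtain ⟨r1, h1, -⟩ := h.aggAvg_near hOK hgood le_rfl hc hmax (lo := μ imax - ε)
        (hi' := μ imax) (fun j hj => by have := abs_lt.1 (h.mean_near hj); linarith)
        (fun j _ => h.le_max j)
      obtain ⟨r2, -, h2⟩ := h.aggAvg_near hOK hgood le_rfl hc hi' (lo := μ i - ε)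
        (hi' := μ i + ε) (fun j hj => by have := abs_lt.1 (h.mean_near hj); linarith)
        (fun j hj => by have := abs_lt.1 (h.mean_near hj); linarith)
      have := h.acc
      refine ⟨imax, hmax, ?_⟩
      linarith
    simp only [epoch, hc, if_false] at hmem hel
    exact (Finset.mem_filter.1 hmem).2 hel

end

section
variable {K : ℕ} {ε lam : ℝ} {T : ℕ} {ES ED : Finset (Sym2 (Fin K))} {z μ : Fin K → ℝ}
  {imax : Fin K} {arm : ℕ → Fin K} {rew : ℕ → ℝ}

/-! ### The index phase -/

theorem devSum_singleton (μ : Fin K → ℝ) (arm : ℕ → Fin K) (rew : ℕ → ℝ) (i : Fin K) (t : ℕ) :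
    devSum μ arm rew {i} (plays arm i t) t = plays arm i t * (avg arm rew i t - μ i) := by
  rw [devSum_eq μ arm rew {i} le_rfl (plays_eq_setPlays arm i t).symm, mul_sub,
    mul_comm _ (avg arm rew i t), avg_mul_plays]
  simp only [Finset.mem_singleton, Finset.sum_sub_distrib]
  congr 1
  rw [Finset.sum_congr rfl fun s hs => by rw [(Finset.mem_filter.1 hs).2]]
  simp [plays]

/-- The tolerance of the index phase for the sum of `n` rewards in round `t`. -/
def ucbTol (n t : ℕ) : ℝ := Real.sqrt (2 * n * Real.log t)

theorem mul_ucb_width {n t : ℕ} (hn : n ≠ 0) :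
    (n : ℝ) * Real.sqrt (2 * Real.log t / n) = ucbTol n t := by
  have hn' : (0 : ℝ) < n := by exact_mod_cast Nat.pos_of_ne_zero hn
  unfold ucbTol
  conv_lhs => rw [← Real.sqrt_sq hn'.le]
  rw [← Real.sqrt_mul (sq_nonneg _), Real.sqrt_sq hn'.le]
  congr 1
  field_simp

/-- A suboptimal arm whose index beats that of a best arm has few plays, unless rewards deviate. -/
theorem plays_le_of_index_le {t T : ℕ} (htT : t < T) {i b : Fin K} {δ : ℝ} (hδ : 0 < δ)
    (hgap : δ ≤ μ b - μ i) (hidx : armIndex arm rew b t ≤ armIndex arm rew i t)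
    (hi : ∀ n ∈ Finset.Icc 1 t, 1 * devSum μ arm rew {i} n t < ucbTol n t)
    (hb : ∀ n ∈ Finset.Icc 1 t, (-1) * devSum μ arm rew {b} n t < ucbTol n t) :
    (plays arm i t : ℝ) ≤ 8 * Real.log T / δ ^ 2 := by
  by_contra hc
  push Not at hc
  have hlogT : 0 ≤ Real.log T := Real.log_natCast_nonneg T
  have hpos : (0 : ℝ) < plays arm i t := lt_of_le_of_lt (by positivity) hc
  have hi0 : plays arm i t ≠ 0 := by
    intro h; rw [h] at hpos; simp at hpos
  have hmem : ∀ j : Fin K, plays arm j t ≠ 0 → plays arm j t ∈ Finset.Icc 1 t := fun j hj => by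
    rw [Finset.mem_Icc]
    refine ⟨Nat.one_le_iff_ne_zero.2 hj, ?_⟩
    rw [plays_eq_setPlays]; exact setPlays_le _ _ _
  -- An unplayed `b` would have index `⊤`, above the finite index of `i`.
  have hb0 : plays arm b t ≠ 0 := by
    intro h
    unfold armIndex at hidx
    rw [if_pos h, if_neg hi0] at hidx
    exact EReal.coe_ne_top _ (top_le_iff.1 hidx)
  unfold armIndex at hidx
  rw [if_neg hb0, if_neg hi0, EReal.coe_le_coe_iff] at hidx
  have d1 := hi _ (hmem i hi0)
  have d2 := hb _ (hmem b hb0)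
  rw [devSum_singleton μ arm rew i t, ← mul_ucb_width hi0, one_mul] at d1
  rw [devSum_singleton μ arm rew b t, ← mul_ucb_width hb0] at d2
  have hposb : (0 : ℝ) < plays arm b t := by exact_mod_cast Nat.pos_of_ne_zero hb0
  have d1' := lt_of_mul_lt_mul_left d1 hpos.le
  have d2' : -(avg arm rew b t - μ b) < Real.sqrt (2 * Real.log t / plays arm b t) := by
    refine lt_of_mul_lt_mul_left (a := (plays arm b t : ℝ)) ?_ hposb.le
    linarith
  -- The index of `b` exceeds `μ b`, the average of `i` is below `μ i` plus its width, and the index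
  -- of `i` adds the width once more.
  have hs : δ < 2 * Real.sqrt (2 * Real.log t / plays arm i t) := by linarith
  have ht : Real.log t ≤ Real.log T := by
    rcases Nat.eq_zero_or_pos t with h | h
    · simpa [h] using hlogT
    · exact Real.log_le_log (by exact_mod_cast h) (by exact_mod_cast htT.le)
  have hlogt : 0 ≤ Real.log t := Real.log_natCast_nonneg t
  have hsq : δ ^ 2 < 4 * (2 * Real.log t / plays arm i t) := by
    have h2 : (2 * Real.sqrt (2 * Real.log t / plays arm i t)) ^ 2 =
        4 * (2 * Real.log t / plays arm i t) := by
      rw [mul_pow, Real.sq_sqrt (by positivity)]; ring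
    rw [← h2]
    exact pow_lt_pow_left₀ hs hδ.le two_ne_zero
  rw [← mul_div_assoc, lt_div_iff₀ hpos] at hsq
  rw [div_lt_iff₀ (by positivity)] at hc
  nlinarith

open Classical in
/-- The indicator of a deviation of at least `a` in direction `σ`. -/
def devInd (μ : Fin K → ℝ) (arm : ℕ → Fin K) (rew : ℕ → ℝ) (a σ : ℝ) (N : Finset (Fin K))
    (n t : ℕ) : ℝ := if a ≤ σ * devSum μ arm rew N n t then 1 else 0

theorem devInd_nonneg (a σ : ℝ) (N : Finset (Fin K)) (n t : ℕ) :
    0 ≤ devInd μ arm rew a σ N n t := by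
  unfold devInd; split_ifs <;> simp

theorem devInd_eq_one {a σ : ℝ} {N : Finset (Fin K)} {n t : ℕ}
    (h : a ≤ σ * devSum μ arm rew N n t) : devInd μ arm rew a σ N n t = 1 := if_pos h

/-- The number of deviations of exploration averages. -/
def exploreDev (lam : ℝ) (T L : ℕ) (ES ED : Finset (Sym2 (Fin K))) (z μ : Fin K → ℝ)
    (arm : ℕ → Fin K) (rew : ℕ → ℝ) : ℝ :=
  ∑ m ∈ Finset.range (L + 1), ∑ i ∈ remaining ES ED,
    (devInd μ arm rew (aggTol lam T ES ED z m i) 1 (simNbhd ES ED i)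
        (aggTarget lam T ES ED z m i) T +
      devInd μ arm rew (aggTol lam T ES ED z m i) (-1) (simNbhd ES ED i)
        (aggTarget lam T ES ED z m i) T)

/-- The number of deviations of arm `i` upwards or arm `b` downwards in round `t`. -/
def indexDev (μ : Fin K → ℝ) (arm : ℕ → Fin K) (rew : ℕ → ℝ) (i b : Fin K) (t : ℕ) : ℝ :=
  ∑ n ∈ Finset.Icc 1 t, (devInd μ arm rew (ucbTol n t) 1 {i} n t +
    devInd μ arm rew (ucbTol n t) (-1) {b} n t)

theorem exploreDev_nonneg (lam : ℝ) (T L : ℕ) (ES ED : Finset (Sym2 (Fin K))) (z : Fin K → ℝ) :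
    0 ≤ exploreDev lam T L ES ED z μ arm rew :=
  Finset.sum_nonneg fun _ _ => Finset.sum_nonneg fun _ _ =>
    add_nonneg (devInd_nonneg _ _ _ _ _) (devInd_nonneg _ _ _ _ _)

theorem indexDev_nonneg (i b : Fin K) (t : ℕ) : 0 ≤ indexDev μ arm rew i b t :=
  Finset.sum_nonneg fun _ _ => add_nonneg (devInd_nonneg _ _ _ _ _) (devInd_nonneg _ _ _ _ _)

theorem one_le_exploreDev {L : ℕ}
    (h : ¬ WellEstimated lam T L ES ED z μ arm rew) :
    1 ≤ exploreDev lam T L ES ED z μ arm rew := by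
  unfold WellEstimated at h
  push Not at h
  obtain ⟨m, hm, i, hi, hdev⟩ := h
  have hnn : ∀ m i, 0 ≤ devInd μ arm rew (aggTol lam T ES ED z m i) 1 (simNbhd ES ED i)
        (aggTarget lam T ES ED z m i) T +
      devInd μ arm rew (aggTol lam T ES ED z m i) (-1) (simNbhd ES ED i)
        (aggTarget lam T ES ED z m i) T := fun m i =>
    add_nonneg (devInd_nonneg _ _ _ _ _) (devInd_nonneg _ _ _ _ _)
  have h1 : 1 ≤ devInd μ arm rew (aggTol lam T ES ED z m i) 1 (simNbhd ES ED i)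
        (aggTarget lam T ES ED z m i) T +
      devInd μ arm rew (aggTol lam T ES ED z m i) (-1) (simNbhd ES ED i)
        (aggTarget lam T ES ED z m i) T := by
    rcases le_abs.1 hdev with h | h
    · rw [devInd_eq_one (by rw [one_mul]; exact h)]
      linarith [devInd_nonneg (μ := μ) (arm := arm) (rew := rew) (aggTol lam T ES ED z m i) (-1)
        (simNbhd ES ED i) (aggTarget lam T ES ED z m i) T]
    · rw [devInd_eq_one (σ := -1) (by linarith)]
      linarith [devInd_nonneg (μ := μ) (arm := arm) (rew := rew) (aggTol lam T ES ED z m i) 1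
        (simNbhd ES ED i) (aggTarget lam T ES ED z m i) T]
  refine h1.trans ?_
  refine le_trans (Finset.single_le_sum (f := fun i => devInd μ arm rew (aggTol lam T ES ED z m i) 1
        (simNbhd ES ED i) (aggTarget lam T ES ED z m i) T +
      devInd μ arm rew (aggTol lam T ES ED z m i) (-1) (simNbhd ES ED i)
        (aggTarget lam T ES ED z m i) T) (fun j _ => hnn m j) hi) ?_
  exact Finset.single_le_sum (f := fun m => ∑ i ∈ remaining ES ED,
      (devInd μ arm rew (aggTol lam T ES ED z m i) 1
        (simNbhd ES ED i) (aggTarget lam T ES ED z m i) T +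
      devInd μ arm rew (aggTol lam T ES ED z m i) (-1) (simNbhd ES ED i)
        (aggTarget lam T ES ED z m i) T))
    (fun m _ => Finset.sum_nonneg fun j _ => hnn m j) (Finset.mem_range.2 (by omega))

theorem one_le_indexDev {i b : Fin K} {t : ℕ}
    (h : ¬ ((∀ n ∈ Finset.Icc 1 t, 1 * devSum μ arm rew {i} n t < ucbTol n t) ∧
      ∀ n ∈ Finset.Icc 1 t, (-1) * devSum μ arm rew {b} n t < ucbTol n t)) :
    1 ≤ indexDev μ arm rew i b t := by
  have hnn : ∀ n, 0 ≤ devInd μ arm rew (ucbTol n t) 1 {i} n t +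
    devInd μ arm rew (ucbTol n t) (-1) {b} n t := fun n =>
    add_nonneg (devInd_nonneg _ _ _ _ _) (devInd_nonneg _ _ _ _ _)
  have hn : ∃ n ∈ Finset.Icc 1 t, 1 ≤ devInd μ arm rew (ucbTol n t) 1 {i} n t +
      devInd μ arm rew (ucbTol n t) (-1) {b} n t := by
    by_cases h1 : ∀ n ∈ Finset.Icc 1 t, 1 * devSum μ arm rew {i} n t < ucbTol n t
    · have h2 : ¬ ∀ n ∈ Finset.Icc 1 t, (-1) * devSum μ arm rew {b} n t < ucbTol n t :=
        fun h2 => h ⟨h1, h2⟩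
      push Not at h2
      obtain ⟨n, hn, hle⟩ := h2
      refine ⟨n, hn, ?_⟩
      rw [devInd_eq_one hle]
      linarith [devInd_nonneg (μ := μ) (arm := arm) (rew := rew) (ucbTol n t) 1 {i} n t]
    · push Not at h1
      obtain ⟨n, hn, hle⟩ := h1
      refine ⟨n, hn, ?_⟩
      rw [devInd_eq_one hle]
      linarith [devInd_nonneg (μ := μ) (arm := arm) (rew := rew) (ucbTol n t) (-1) {b} n t]
  obtain ⟨n, hn, h1⟩ := hn
  exact h1.trans (Finset.single_le_sum (f := fun n => devInd μ arm rew (ucbTol n t) 1 {i} n t +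
    devInd μ arm rew (ucbTol n t) (-1) {b} n t) (fun n _ => hnn n) hn)

/-! ### The loss along a run -/

/-- Loss along a run, if the arms of the index phase are either optimal or belong to `Q`. -/
theorem Admissible.loss_le (h : Admissible ε lam T ES ED z μ imax)
    (hOK : ∀ t < T, StepOK ε lam T ES ED z arm rew t) {δ Δ : ℝ} (hδ : 0 < δ) (hΔ : 0 ≤ Δ)
    (hgap : ∀ i, μ i < μ imax → δ ≤ μ imax - μ i ∧ μ imax - μ i ≤ Δ)
    (Q : Finset (Fin K)) (hQ : ∀ i ∈ remaining ES ED, μ i < μ imax → μ imax - μ i ≤ 4 * ε → i ∈ Q) :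
    ∑ t ∈ Finset.range T, (μ imax - μ (arm t)) ≤
      Δ * ((∑ i ∈ remaining ES ED, target lam T z (lastEpoch ε lam T) i : ℕ) +
        T * exploreDev lam T (lastEpoch ε lam T) ES ED z μ arm rew +
        ∑ i ∈ Q, (8 * Real.log T / δ ^ 2 + 1 +
          ∑ t ∈ Finset.range T, indexDev μ arm rew i imax t)) := by
  classical
  have hgap' : ∀ i, μ imax - μ i ≤ Δ := fun i => by
    rcases (h.le_max i).lt_or_eq with h1 | h1
    · exact (hgap i h1).2
    · rw [h1]; simpa using hΔ
  have hlogT : 0 ≤ Real.log T := Real.log_natCast_nonneg T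
  have hidx0 : 0 ≤ ∑ i ∈ Q, (8 * Real.log T / δ ^ 2 + 1 +
      ∑ t ∈ Finset.range T, indexDev μ arm rew i imax t) :=
    Finset.sum_nonneg fun i _ => add_nonneg (by positivity)
      (Finset.sum_nonneg fun t _ => indexDev_nonneg _ _ _)
  by_cases hgood : WellEstimated lam T (lastEpoch ε lam T) ES ED z μ arm rew
  swap
  -- After a failure of the estimates the loss of the whole horizon is charged to the deviation
  -- count.
  · have h1 := one_le_exploreDev hgood
    have h2 : ∑ t ∈ Finset.range T, (μ imax - μ (arm t)) ≤ T * Δ := by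
      have := Finset.sum_le_card_nsmul (Finset.range T) (fun t => μ imax - μ (arm t)) Δ
        fun t _ => hgap' _
      simpa using this
    refine h2.trans ?_
    rw [mul_comm]
    refine mul_le_mul_of_nonneg_left ?_ hΔ
    have h3 : (T : ℝ) ≤ T * exploreDev lam T (lastEpoch ε lam T) ES ED z μ arm rew :=
      le_mul_of_one_le_right (Nat.cast_nonneg _) h1
    have h4 : (0 : ℝ) ≤ (∑ i ∈ remaining ES ED, target lam T z (lastEpoch ε lam T) i : ℕ) :=
      Nat.cast_nonneg _
    linarith
  · obtain ⟨hBsub, -, -, -, -⟩ := h.epoch_inv hOK _ le_rfl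
    have hle := h.epoch_le hOK
    have hmaxB := h.max_survives hOK hgood _ le_rfl
    set e := (epoch ε lam T ES ED z arm rew (lastEpoch ε lam T + 1)).1 with he
    set B := (epoch ε lam T ES ED z arm rew (lastEpoch ε lam T + 1)).2 with hB
    have hu : ∀ i ∈ Q, (((Finset.range T).filter fun t => arm t = i ∧
        (plays arm i t : ℝ) ≤ 8 * Real.log T / δ ^ 2).card : ℝ) ≤ 8 * Real.log T / δ ^ 2 + 1 := by
      intro i _
      have h1 := card_early_plays_le arm i (⌊8 * Real.log T / δ ^ 2⌋₊ + 1) T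
      have h2 : ((Finset.range T).filter fun t => arm t = i ∧
          (plays arm i t : ℝ) ≤ 8 * Real.log T / δ ^ 2).card ≤ ⌊8 * Real.log T / δ ^ 2⌋₊ + 1 := by
        refine le_trans (Finset.card_le_card fun t ht => ?_) h1
        simp only [Finset.mem_filter] at ht ⊢
        exact ⟨ht.1, ht.2.1, Nat.lt_succ_of_le (Nat.le_floor ht.2.2)⟩
      calc _ ≤ ((⌊8 * Real.log T / δ ^ 2⌋₊ + 1 : ℕ) : ℝ) := by exact_mod_cast h2
        _ ≤ _ := by
          push_cast
          have := Nat.floor_le (a := 8 * Real.log T / δ ^ 2) (by positivity)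
          linarith
    -- A suboptimal round after exploration is paid for by an arm of `Q`: either that arm has few
    -- plays so far, or a deviation occurs.
    have hterm : ∀ t ∈ Finset.range T, μ imax - μ (arm t) ≤
        Δ * ((if t < e then 1 else 0) + ∑ i ∈ Q, ((if arm t = i ∧
          (plays arm i t : ℝ) ≤ 8 * Real.log T / δ ^ 2 then 1 else 0) +
            indexDev μ arm rew i imax t)) := by
      intro t ht
      have htT := Finset.mem_range.1 ht
      have hsum0 : ∀ i ∈ Q, (0 : ℝ) ≤ (if arm t = i ∧
          (plays arm i t : ℝ) ≤ 8 * Real.log T / δ ^ 2 then 1 else 0) +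
            indexDev μ arm rew i imax t := fun i _ =>
        add_nonneg (by split_ifs <;> simp) (indexDev_nonneg _ _ _)
      have hnn := Finset.sum_nonneg hsum0
      by_cases hte : t < e
      · rw [if_pos hte]
        refine (hgap' (arm t)).trans (le_mul_of_one_le_right hΔ ?_)
        linarith
      · rw [if_neg hte, zero_add]
        obtain ⟨hmem, hix⟩ := (hOK t htT).ucb (not_lt.1 hte)
        rcases (h.le_max (arm t)).lt_or_eq with hlt | heq
        · have h4 : μ imax - μ (arm t) ≤ 4 * ε := by
            by_contra hc
            exact h.bad_eliminated hOK hgood (not_le.1 hc) hmem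
          have hq := hQ _ (hBsub hmem) hlt h4
          refine (hgap' (arm t)).trans (le_mul_of_one_le_right hΔ ?_)
          refine le_trans ?_ (Finset.single_le_sum hsum0 hq)
          by_cases hdev : (∀ n ∈ Finset.Icc 1 t, 1 * devSum μ arm rew {arm t} n t < ucbTol n t) ∧
              ∀ n ∈ Finset.Icc 1 t, (-1) * devSum μ arm rew {imax} n t < ucbTol n t
          · have := plays_le_of_index_le htT hδ (hgap _ hlt).1 (hix imax hmaxB) hdev.1 hdev.2
            rw [if_pos ⟨rfl, this⟩]
            linarith [indexDev_nonneg (μ := μ) (arm := arm) (rew := rew) (arm t) imax t]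
          · have := one_le_indexDev hdev
            have : (0 : ℝ) ≤ if arm t = arm t ∧
                (plays arm (arm t) t : ℝ) ≤ 8 * Real.log T / δ ^ 2 then 1 else 0 := by
              split_ifs <;> simp
            linarith
        · rw [heq, sub_self]
          exact mul_nonneg hΔ hnn
    refine (Finset.sum_le_sum hterm).trans ?_
    rw [← Finset.mul_sum]
    refine mul_le_mul_of_nonneg_left ?_ hΔ
    rw [Finset.sum_add_distrib, Finset.sum_comm]
    have e1 : ∑ t ∈ Finset.range T, (if t < e then (1 : ℝ) else 0) ≤
        (∑ i ∈ remaining ES ED, target lam T z (lastEpoch ε lam T) i : ℕ) := by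
      rw [Finset.sum_boole]
      have : ((Finset.range T).filter fun t => t < e).card ≤ e := by
        refine (Finset.card_le_card (t := Finset.range e) fun t ht => ?_).trans (by simp)
        simpa using (Finset.mem_filter.1 ht).2
      exact_mod_cast this.trans hle
    have e2 : 0 ≤ (T : ℝ) * exploreDev lam T (lastEpoch ε lam T) ES ED z μ arm rew :=
      mul_nonneg (Nat.cast_nonneg _) (exploreDev_nonneg _ _ _ _ _ _)
    have e3 : ∑ i ∈ Q, ∑ t ∈ Finset.range T, ((if arm t = i ∧
          (plays arm i t : ℝ) ≤ 8 * Real.log T / δ ^ 2 then 1 else 0) +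
            indexDev μ arm rew i imax t) ≤ ∑ i ∈ Q, (8 * Real.log T / δ ^ 2 + 1 +
          ∑ t ∈ Finset.range T, indexDev μ arm rew i imax t) := by
      refine Finset.sum_le_sum fun i hi => ?_
      rw [Finset.sum_add_distrib, Finset.sum_boole]
      exact add_le_add (hu i hi) le_rfl
    linarith

end

/-! ### The regret for given side information -/

theorem devInd_eq_indicator {K : ℕ} {Ω : Type*} (X : ℕ → Ω → Fin K → ℝ) (μ : Fin K → ℝ)
    (π : Policy K) (a σ : ℝ) (N : Finset (Fin K)) (n t : ℕ) :
    (fun ω => devInd μ (armAt π fun s => X s ω) (rewAt π fun s => X s ω) a σ N n t) =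
      Set.indicator {ω | a ≤ σ * devSum μ (armAt π fun s => X s ω) (rewAt π fun s => X s ω) N n t}
        (fun _ => (1 : ℝ)) := by
  classical
  ext ω
  simp only [devInd, Set.indicator_apply, Set.mem_ofPred_eq]

section
variable {K : ℕ} {Ω : Type*} [MeasurableSpace Ω] {P : Measure Ω}
  {X : ℕ → Ω → Fin K → ℝ} {ε lam : ℝ} {T : ℕ} {ES ED : Finset (Sym2 (Fin K))}
  {z μ : Fin K → ℝ} {imax : Fin K} {π : Policy K}

theorem measurableSet_dev (h : IsRewards P X μ) (hπ : ∀ t, Measurable (π t)) (a σ : ℝ)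
    (N : Finset (Fin K)) (n t : ℕ) :
    MeasurableSet {ω | a ≤ σ * devSum μ (armAt π fun s => X s ω) (rewAt π fun s => X s ω) N n t} :=
  measurableSet_le measurable_const
    (((measurable_devSum hπ N n t).comp h.measurable_path).const_mul σ)

variable [IsProbabilityMeasure P]

theorem integrable_devInd (h : IsRewards P X μ) (hπ : ∀ t, Measurable (π t)) (a σ : ℝ)
    (N : Finset (Fin K)) (n t : ℕ) :
    Integrable (fun ω => devInd μ (armAt π fun s => X s ω) (rewAt π fun s => X s ω) a σ N n t)
      P := by
  rw [devInd_eq_indicator]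
  exact (integrable_const _).indicator (measurableSet_dev h hπ a σ N n t)

theorem integral_devInd_le (h : IsRewards P X μ) (hπ : ∀ t, Measurable (π t)) {a σ : ℝ}
    (ha : 0 ≤ a) (hσ : σ ^ 2 = 1) (N : Finset (Fin K)) {n : ℕ} (hn : 0 < n) (t : ℕ) :
    ∫ ω, devInd μ (armAt π fun s => X s ω) (rewAt π fun s => X s ω) a σ N n t ∂P ≤
      Real.exp (-(2 * a ^ 2 / n)) := by
  rw [devInd_eq_indicator, integral_indicator_const _ (measurableSet_dev h hπ a σ N n t)]
  simpa using measure_devSum_ge_le h hπ N hn t ha σ hσ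

/-- The radius is chosen so that each one-sided deviation has probability at most `1 / (T * gapEst m
^ 2)`. The factor `T` cancels in the union bound over epochs and arms. -/
theorem Admissible.integral_exploreDev_le (hA : Admissible ε lam T ES ED z μ imax)
    (h : IsRewards P X μ) (hπ : ∀ t, Measurable (π t)) :
    Integrable (fun ω => exploreDev lam T (lastEpoch ε lam T) ES ED z μ
      (armAt π fun s => X s ω) (rewAt π fun s => X s ω)) P ∧
    T * ∫ ω, exploreDev lam T (lastEpoch ε lam T) ES ED z μ (armAt π fun s => X s ω)
      (rewAt π fun s => X s ω) ∂P ≤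
      (lastEpoch ε lam T + 1) * (K * (2 / gapEst (lastEpoch ε lam T) ^ 2)) := by
  have hint := fun a σ N n t => integrable_devInd (P := P) h hπ a σ N n t
  have hint2 : ∀ a σ N n a' σ' N' n' t, Integrable (fun ω =>
      devInd μ (armAt π fun s => X s ω) (rewAt π fun s => X s ω) a σ N n t +
        devInd μ (armAt π fun s => X s ω) (rewAt π fun s => X s ω) a' σ' N' n' t) P :=
    fun _ _ _ _ _ _ _ _ _ => (hint _ _ _ _ _).add (hint _ _ _ _ _)
  unfold exploreDev
  refine ⟨integrable_finsetSum _ fun m _ => integrable_finsetSum _ fun i _ =>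
    hint2 _ _ _ _ _ _ _ _ _, ?_⟩
  rw [integral_finsetSum _ fun m _ => integrable_finsetSum _ fun i _ =>
    hint2 _ _ _ _ _ _ _ _ _, Finset.mul_sum]
  have hT : (0 : ℝ) < T := by
    have := hA.exp_le
    by_contra hc
    have h0 : (T : ℝ) ≤ 0 := not_lt.1 hc
    have := Real.exp_pos 1
    nlinarith [sq_nonneg (gapEst (lastEpoch ε lam T))]
  have hm : ∀ m ∈ Finset.range (lastEpoch ε lam T + 1),
      (T : ℝ) * ∫ ω, ∑ i ∈ remaining ES ED,
        (devInd μ (armAt π fun s => X s ω) (rewAt π fun s => X s ω) (aggTol lam T ES ED z m i) 1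
            (simNbhd ES ED i) (aggTarget lam T ES ED z m i) T +
          devInd μ (armAt π fun s => X s ω) (rewAt π fun s => X s ω) (aggTol lam T ES ED z m i) (-1)
            (simNbhd ES ED i) (aggTarget lam T ES ED z m i) T) ∂P ≤
      K * (2 / gapEst (lastEpoch ε lam T) ^ 2) := by
    intro m hm
    have hmL : m ≤ lastEpoch ε lam T := Nat.lt_succ_iff.1 (Finset.mem_range.1 hm)
    rw [integral_finsetSum _ fun i _ => hint2 _ _ _ _ _ _ _ _ _, Finset.mul_sum]
    have hi : ∀ i ∈ remaining ES ED, (T : ℝ) * ∫ ω,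
        (devInd μ (armAt π fun s => X s ω) (rewAt π fun s => X s ω) (aggTol lam T ES ED z m i) 1
            (simNbhd ES ED i) (aggTarget lam T ES ED z m i) T +
          devInd μ (armAt π fun s => X s ω) (rewAt π fun s => X s ω) (aggTol lam T ES ED z m i) (-1)
            (simNbhd ES ED i) (aggTarget lam T ES ED z m i) T) ∂P ≤
        2 / gapEst (lastEpoch ε lam T) ^ 2 := by
      intro i hi
      have hn := hA.aggTarget_pos hmL hi
      have hn' : (0 : ℝ) < aggTarget lam T ES ED z m i := by exact_mod_cast hn
      have hg := gapEst_pos m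
      have hgL := gapEst_pos (lastEpoch ε lam T)
      have hlog := hA.one_le_log hmL
      have ha : 0 ≤ aggTol lam T ES ED z m i := by unfold aggTol; positivity
      have hexp : Real.exp (-(2 * aggTol lam T ES ED z m i ^ 2 / aggTarget lam T ES ED z m i)) =
          1 / (T * gapEst m ^ 2) := by
        have : 2 * aggTol lam T ES ED z m i ^ 2 / aggTarget lam T ES ED z m i =
            Real.log (T * gapEst m ^ 2) := by
          unfold aggTol
          rw [mul_pow, Real.sq_sqrt (by positivity)]
          field_simp
        rw [this, Real.exp_neg, Real.exp_log (by positivity), one_div]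
      rw [integral_add (hint _ _ _ _ _) (hint _ _ _ _ _)]
      have b1 := integral_devInd_le h hπ ha (σ := 1) (by norm_num) (simNbhd ES ED i) hn T
      have b2 := integral_devInd_le h hπ ha (σ := -1) (by norm_num) (simNbhd ES ED i) hn T
      rw [hexp] at b1 b2
      calc _ ≤ (T : ℝ) * (1 / (T * gapEst m ^ 2) + 1 / (T * gapEst m ^ 2)) :=
            mul_le_mul_of_nonneg_left (add_le_add b1 b2) hT.le
        _ = 2 / gapEst m ^ 2 := by field_simp; ring
        _ ≤ _ := by
          have := gapEst_anti hmL
          gcongr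
    calc _ ≤ ∑ i ∈ remaining ES ED, 2 / gapEst (lastEpoch ε lam T) ^ 2 := Finset.sum_le_sum hi
      _ = (remaining ES ED).card * (2 / gapEst (lastEpoch ε lam T) ^ 2) := by
          rw [Finset.sum_const, nsmul_eq_mul]
      _ ≤ _ := by
          have : (remaining ES ED).card ≤ K := by
            simpa using Finset.card_le_univ (remaining ES ED)
          gcongr
  calc _ ≤ ∑ m ∈ Finset.range (lastEpoch ε lam T + 1),
      (K : ℝ) * (2 / gapEst (lastEpoch ε lam T) ^ 2) := Finset.sum_le_sum hm
    _ = _ := by rw [Finset.sum_const, nsmul_eq_mul, Finset.card_range]; push_cast; ring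

theorem integral_indexDev_le (h : IsRewards P X μ) (hπ : ∀ t, Measurable (π t)) (i b : Fin K)
    (t : ℕ) :
    Integrable (fun ω => indexDev μ (armAt π fun s => X s ω) (rewAt π fun s => X s ω) i b t) P ∧
    ∫ ω, indexDev μ (armAt π fun s => X s ω) (rewAt π fun s => X s ω) i b t ∂P ≤
      2 * (t : ℝ)⁻¹ := by
  have hint := fun a σ N n t => integrable_devInd (P := P) h hπ a σ N n t
  have hint2 : ∀ a σ N n a' σ' N' n' t, Integrable (fun ω =>
      devInd μ (armAt π fun s => X s ω) (rewAt π fun s => X s ω) a σ N n t +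
        devInd μ (armAt π fun s => X s ω) (rewAt π fun s => X s ω) a' σ' N' n' t) P :=
    fun _ _ _ _ _ _ _ _ _ => (hint _ _ _ _ _).add (hint _ _ _ _ _)
  unfold indexDev
  refine ⟨integrable_finsetSum _ fun n _ => hint2 _ _ _ _ _ _ _ _ _, ?_⟩
  rw [integral_finsetSum _ fun n _ => hint2 _ _ _ _ _ _ _ _ _]
  rcases Nat.eq_zero_or_pos t with rfl | ht
  · simp
  have ht' : (1 : ℝ) ≤ t := by exact_mod_cast ht
  have hn : ∀ n ∈ Finset.Icc 1 t, ∫ ω,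
      (devInd μ (armAt π fun s => X s ω) (rewAt π fun s => X s ω) (ucbTol n t) 1 {i} n t +
        devInd μ (armAt π fun s => X s ω) (rewAt π fun s => X s ω) (ucbTol n t) (-1) {b} n t) ∂P ≤
      2 / (t : ℝ) ^ 2 := by
    intro n hn
    have hn1 := (Finset.mem_Icc.1 hn).1
    have hn0 : (0 : ℝ) < n := by exact_mod_cast hn1
    have hlog : 0 ≤ Real.log t := Real.log_natCast_nonneg t
    -- The exponential equals `t ^ (-4)`. The weaker `t ^ (-2)` suffices: a union over `n ≤ t` gives
    -- `2 / t`, whose sum over rounds is still of order `log T`.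
    have hexp : Real.exp (-(2 * ucbTol n t ^ 2 / n)) ≤ 1 / (t : ℝ) ^ 2 := by
      have : 2 * ucbTol n t ^ 2 / n = 4 * Real.log t := by
        unfold ucbTol
        rw [Real.sq_sqrt (by positivity)]
        field_simp; ring
      have h2 : 1 / (t : ℝ) ^ 2 = Real.exp (-(2 * Real.log t)) := by
        rw [Real.exp_neg, one_div, two_mul, Real.exp_add, Real.exp_log (by positivity), sq]
      rw [this, h2]
      exact Real.exp_le_exp.2 (by linarith)
    rw [integral_add (hint _ _ _ _ _) (hint _ _ _ _ _)]
    have b1 := integral_devInd_le h hπ (a := ucbTol n t) (Real.sqrt_nonneg _) (σ := 1)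
      (by norm_num) {i} hn1 t
    have b2 := integral_devInd_le h hπ (a := ucbTol n t) (Real.sqrt_nonneg _) (σ := -1)
      (by norm_num) {b} hn1 t
    calc _ ≤ 1 / (t : ℝ) ^ 2 + 1 / (t : ℝ) ^ 2 := add_le_add (b1.trans hexp) (b2.trans hexp)
      _ = _ := by ring
  calc _ ≤ ∑ n ∈ Finset.Icc 1 t, 2 / (t : ℝ) ^ 2 := Finset.sum_le_sum hn
    _ = _ := by
      rw [Finset.sum_const, nsmul_eq_mul, Nat.card_Icc]
      simp only [Nat.add_sub_cancel]
      field_simp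

theorem sum_range_inv_le (T : ℕ) : ∑ t ∈ Finset.range T, (t : ℝ)⁻¹ ≤ 1 + Real.log T := by
  rcases Nat.eq_zero_or_pos T with rfl | hT
  · simp
  obtain ⟨n, rfl⟩ : ∃ n, T = n + 1 := ⟨T - 1, by omega⟩
  rw [Finset.sum_range_succ']
  have h := harmonic_le_one_add_log n
  unfold harmonic at h
  push_cast at h ⊢
  have h2 : Real.log n ≤ Real.log (n + 1) := by
    rcases Nat.eq_zero_or_pos n with rfl | hn
    · simp
    · exact Real.log_le_log (by exact_mod_cast hn) (by linarith)
  simp only [inv_zero, add_zero]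
  linarith

theorem Admissible.regret_le (hA : Admissible ε lam T ES ED z μ imax)
    (h : IsRewards P X μ) (hπ : ∀ t, Measurable (π t))
    (hOK : ∀ x : ℕ → Fin K → ℝ, ∀ t < T, StepOK ε lam T ES ED z (armAt π x) (rewAt π x) t)
    {δ Δ : ℝ} (hδ : 0 < δ) (hΔ : 0 ≤ Δ)
    (hgap : ∀ i, μ i < μ imax → δ ≤ μ imax - μ i ∧ μ imax - μ i ≤ Δ)
    (Q : Finset (Fin K)) (hQ : ∀ i ∈ remaining ES ED, μ i < μ imax → μ imax - μ i ≤ 4 * ε → i ∈ Q) :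
    regret P X (μ imax) π T ≤
      Δ * ((∑ i ∈ remaining ES ED, target lam T z (lastEpoch ε lam T) i : ℕ) +
        (lastEpoch ε lam T + 1) * (K * (2 / gapEst (lastEpoch ε lam T) ^ 2)) +
        Q.card * ((8 / δ ^ 2 + 2) * Real.log T + 3)) := by
  rw [regret_eq h hπ]
  obtain ⟨i1, b1⟩ := hA.integral_exploreDev_le h hπ
  have i2 := fun i t => (integral_indexDev_le h hπ i imax t).1
  have b2 := fun i t => (integral_indexDev_le h hπ i imax t).2
  have i3 : ∀ i, Integrable (fun ω => 8 * Real.log T / δ ^ 2 + 1 + ∑ t ∈ Finset.range T,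
      indexDev μ (armAt π fun s => X s ω) (rewAt π fun s => X s ω) i imax t) P := fun i =>
    (integrable_const _).add (integrable_finsetSum _ fun t _ => i2 i t)
  have i4 : Integrable (fun ω => ∑ i ∈ Q, (8 * Real.log T / δ ^ 2 + 1 + ∑ t ∈ Finset.range T,
      indexDev μ (armAt π fun s => X s ω) (rewAt π fun s => X s ω) i imax t)) P :=
    integrable_finsetSum _ fun i _ => i3 i
  have i5 : Integrable (fun ω => ((∑ i ∈ remaining ES ED,
        target lam T z (lastEpoch ε lam T) i : ℕ) : ℝ) +
        T * exploreDev lam T (lastEpoch ε lam T) ES ED z μ (armAt π fun s => X s ω)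
          (rewAt π fun s => X s ω)) P := (integrable_const _).add (i1.const_mul _)
  -- The loss is nonnegative, so only the upper bound needs to be integrable.
  have hmono := integral_mono_of_nonneg (μ := P)
    (f := fun ω => ∑ t ∈ Finset.range T, (μ imax - μ (armAt π (fun s => X s ω) t)))
    (Eventually.of_forall fun ω => Finset.sum_nonneg fun t _ => sub_nonneg.2 (hA.le_max _))
    ((i5.add i4).const_mul Δ)
    (Eventually.of_forall fun ω => hA.loss_le (hOK fun s => X s ω) hδ hΔ hgap Q hQ)
  refine hmono.trans ?_
  rw [integral_const_mul]
  refine mul_le_mul_of_nonneg_left ?_ hΔ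
  simp only [Pi.add_apply]
  rw [integral_add i5 i4, integral_add (integrable_const _) (i1.const_mul _), integral_const_mul,
    integral_finsetSum _ fun i _ => i3 i]
  have hQsum : ∑ i ∈ Q, ∫ ω, (8 * Real.log T / δ ^ 2 + 1 + ∑ t ∈ Finset.range T,
      indexDev μ (armAt π fun s => X s ω) (rewAt π fun s => X s ω) i imax t) ∂P ≤
      Q.card * ((8 / δ ^ 2 + 2) * Real.log T + 3) := by
    rw [← nsmul_eq_mul]
    refine Finset.sum_le_card_nsmul _ _ _ fun i _ => ?_
    rw [integral_add (integrable_const _) (integrable_finsetSum _ fun t _ => i2 i t),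
      integral_finsetSum _ fun t _ => i2 i t]
    have h1 : ∑ t ∈ Finset.range T, ∫ ω, indexDev μ (armAt π fun s => X s ω)
        (rewAt π fun s => X s ω) i imax t ∂P ≤ 2 * (1 + Real.log T) := by
      refine (Finset.sum_le_sum fun t _ => b2 i t).trans ?_
      rw [← Finset.mul_sum]
      exact mul_le_mul_of_nonneg_left (sum_range_inv_le T) (by norm_num)
    simp only [integral_const, probReal_univ, one_smul]
    have h2 : 8 * Real.log T / δ ^ 2 = 8 / δ ^ 2 * Real.log T := by ring
    rw [h2]
    linarith
  simp only [integral_const, probReal_univ, one_smul]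
  linarith

end

/-! ### Expectations over random subsets -/

section
variable {α β ι : Type*} [DecidableEq α] [DecidableEq β]

/-- Expectation of `F S` for the random subset `S` of `E` that contains every element with
probability `p`, independently. -/
def subsetExp (p : ℝ) (E : Finset α) (F : Finset α → ℝ) : ℝ :=
  ∑ S ∈ E.powerset, p ^ S.card * (1 - p) ^ (E \ S).card * F S

theorem subsetExp_congr {p : ℝ} {E : Finset α} {F F' : Finset α → ℝ}
    (h : ∀ S ⊆ E, F S = F' S) : subsetExp p E F = subsetExp p E F' :=
  Finset.sum_congr rfl fun S hS => by rw [h S (Finset.mem_powerset.1 hS)]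

theorem subsetExp_mono {p : ℝ} (hp : 0 ≤ p ∧ p ≤ 1) {E : Finset α} {F F' : Finset α → ℝ}
    (h : ∀ S ⊆ E, F S ≤ F' S) : subsetExp p E F ≤ subsetExp p E F' :=
  Finset.sum_le_sum fun S hS => mul_le_mul_of_nonneg_left (h S (Finset.mem_powerset.1 hS))
    (mul_nonneg (pow_nonneg hp.1 _) (pow_nonneg (sub_nonneg.2 hp.2) _))

theorem subsetExp_add (p : ℝ) (E : Finset α) (F F' : Finset α → ℝ) :
    subsetExp p E (fun S => F S + F' S) = subsetExp p E F + subsetExp p E F' := by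
  simp only [subsetExp, mul_add, Finset.sum_add_distrib]

theorem subsetExp_const_mul (p c : ℝ) (E : Finset α) (F : Finset α → ℝ) :
    subsetExp p E (fun S => c * F S) = c * subsetExp p E F := by
  simp only [subsetExp, Finset.mul_sum]
  exact Finset.sum_congr rfl fun S _ => by ring

theorem subsetExp_sum (p : ℝ) (E : Finset α) (s : Finset ι) (F : ι → Finset α → ℝ) :
    subsetExp p E (fun S => ∑ i ∈ s, F i S) = ∑ i ∈ s, subsetExp p E (F i) := by
  simp only [subsetExp, Finset.mul_sum]
  exact Finset.sum_comm

/-- Conditioning on a single element; the computations by induction rest on it. -/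
theorem subsetExp_insert (p : ℝ) {E : Finset α} {e : α} (he : e ∉ E) (F : Finset α → ℝ) :
    subsetExp p (insert e E) F =
      p * subsetExp p E (fun S => F (insert e S)) + (1 - p) * subsetExp p E F := by
  unfold subsetExp
  rw [Finset.sum_powerset_insert he, add_comm, Finset.mul_sum, Finset.mul_sum]
  congr 1
  · refine Finset.sum_congr rfl fun S hS => ?_
    have hS' := Finset.mem_powerset.1 hS
    have heS : e ∉ S := fun h => he (hS' h)
    rw [Finset.card_insert_of_notMem heS, Finset.insert_sdiff_insert,
      Finset.sdiff_insert_of_notMem he]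
    ring
  · refine Finset.sum_congr rfl fun S hS => ?_
    have hS' := Finset.mem_powerset.1 hS
    have heS : e ∉ S := fun h => he (hS' h)
    rw [Finset.insert_sdiff_of_notMem _ heS, Finset.card_insert_of_notMem (by simp [he])]
    ring

theorem subsetExp_const (p c : ℝ) (E : Finset α) : subsetExp p E (fun _ => c) = c := by
  induction E using Finset.induction_on with
  | empty => simp [subsetExp]
  | insert e E he ih => rw [subsetExp_insert p he, ih]; ring

/-- Independence turns the expectation into a product. With `c = exp (-1)` this is the Laplace
transform used for the degrees. -/
theorem subsetExp_prod (p c : ℝ) (s : Finset ι) (a : ι → α) (ha : Set.InjOn a s) (E : Finset α)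
    (hE : ∀ l ∈ s, a l ∈ E) :
    subsetExp p E (fun S => ∏ l ∈ s, if a l ∈ S then c else 1) = (1 - p * (1 - c)) ^ s.card := by
  classical
  induction s using Finset.induction_on generalizing E with
  | empty => simp [subsetExp_const]
  | insert l s hl ih =>
    have hins : E = insert (a l) (E.erase (a l)) :=
      (Finset.insert_erase (hE l (Finset.mem_insert_self l s))).symm
    have hne : ∀ l' ∈ s, a l' ≠ a l := fun l' hl' h => hl
      ((ha (by simp [hl']) (by simp) h) ▸ hl')
    have hih := ih (ha.mono (by simp)) (E.erase (a l)) fun l' hl' =>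
      Finset.mem_erase.2 ⟨hne l' hl', hE l' (by simp [hl'])⟩
    rw [hins, subsetExp_insert p (Finset.notMem_erase _ _)]
    have h1 : subsetExp p (E.erase (a l)) (fun S => ∏ l' ∈ insert l s,
        if a l' ∈ insert (a l) S then c else 1) = c * (1 - p * (1 - c)) ^ s.card := by
      rw [← hih, ← subsetExp_const_mul]
      refine subsetExp_congr fun S _ => ?_
      rw [Finset.prod_insert hl, if_pos (Finset.mem_insert_self _ _)]
      congr 1
      refine Finset.prod_congr rfl fun l' hl' => ?_
      simp [hne l' hl']
    have h2 : subsetExp p (E.erase (a l)) (fun S => ∏ l' ∈ insert l s,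
        if a l' ∈ S then c else 1) = (1 - p * (1 - c)) ^ s.card := by
      rw [← hih]
      refine subsetExp_congr fun S hS => ?_
      have : a l ∉ S := fun h => Finset.notMem_erase _ _ (hS h)
      rw [Finset.prod_insert hl, if_neg this, one_mul]
    rw [h1, h2, Finset.card_insert_of_notMem hl, pow_succ]
    ring

open Classical in
/-- The probability that none of several disjoint triples is fully selected. -/
theorem subsetExp_triples (p q : ℝ) (s : Finset ι) (a b : ι → α) (d : ι → β)
    (ha : Set.InjOn a s) (hb : Set.InjOn b s) (hd : Set.InjOn d s)
    (hab : ∀ l ∈ s, ∀ l' ∈ s, a l ≠ b l') (E : Finset α) (D : Finset β)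
    (haE : ∀ l ∈ s, a l ∈ E) (hbE : ∀ l ∈ s, b l ∈ E) (hdD : ∀ l ∈ s, d l ∈ D) :
    subsetExp p E (fun S => subsetExp q D (fun S' =>
      if ∃ l ∈ s, a l ∈ S ∧ b l ∈ S ∧ d l ∈ S' then 0 else 1)) = (1 - p ^ 2 * q) ^ s.card := by
  induction s using Finset.induction_on generalizing E D with
  | empty => simp [subsetExp_const]
  | insert l s hl ih =>
    have hls : l ∈ insert l s := Finset.mem_insert_self l s
    have hsub : ∀ {l'}, l' ∈ s → l' ∈ insert l s := fun h => Finset.mem_insert_of_mem h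
    have hsub' : (s : Set ι) ⊆ ((insert l s : Finset ι) : Set ι) := by simp
    have na : ∀ l' ∈ s, a l' ≠ a l := fun l' hl' h => hl ((ha (hsub hl') hls h) ▸ hl')
    have nb : ∀ l' ∈ s, b l' ≠ b l := fun l' hl' h => hl ((hb (hsub hl') hls h) ▸ hl')
    have nd : ∀ l' ∈ s, d l' ≠ d l := fun l' hl' h => hl ((hd (hsub hl') hls h) ▸ hl')
    have nab : ∀ l' ∈ s, a l' ≠ b l := fun l' hl' => hab l' (hsub hl') l hls
    have nba : ∀ l' ∈ s, b l' ≠ a l := fun l' hl' => (hab l hls l' (hsub hl')).symm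
    have nab0 : a l ≠ b l := hab l hls l hls
    set E' := (E.erase (a l)).erase (b l) with hE'
    set D' := D.erase (d l) with hD'
    have hE : E = insert (a l) (insert (b l) E') := by
      rw [hE', Finset.insert_erase (Finset.mem_erase.2 ⟨nab0.symm, hbE l hls⟩),
        Finset.insert_erase (haE l hls)]
    have hD : D = insert (d l) D' := (Finset.insert_erase (hdD l hls)).symm
    have hbE' : b l ∉ E' := Finset.notMem_erase _ _
    have haE' : a l ∉ insert (b l) E' := by simp [hE', nab0]
    have haE'' : a l ∉ E' := fun h => haE' (Finset.mem_insert_of_mem h)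
    have hdD' : d l ∉ D' := Finset.notMem_erase _ _
    have hih := ih (ha.mono hsub') (hb.mono hsub') (hd.mono hsub')
      (fun x hx y hy => hab x (hsub hx) y (hsub hy)) E' D'
      (fun x hx => Finset.mem_erase.2 ⟨nab x hx, Finset.mem_erase.2 ⟨na x hx, haE x (hsub hx)⟩⟩)
      (fun x hx => Finset.mem_erase.2 ⟨nb x hx, Finset.mem_erase.2 ⟨nba x hx, hbE x (hsub hx)⟩⟩)
      (fun x hx => Finset.mem_erase.2 ⟨nd x hx, hdD x (hsub hx)⟩)
    have hins : ∀ (S : Finset α) (S' : Finset β),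
        (∃ l' ∈ insert l s, a l' ∈ S ∧ b l' ∈ S ∧ d l' ∈ S') ↔
          (a l ∈ S ∧ b l ∈ S ∧ d l ∈ S') ∨ ∃ l' ∈ s, a l' ∈ S ∧ b l' ∈ S ∧ d l' ∈ S' := by
      intro S S'; simp
    have hex : ∀ (S S₁ : Finset α) (S' S₁' : Finset β),
        (∀ x, x ≠ a l → x ≠ b l → (x ∈ S₁ ↔ x ∈ S)) → (∀ x, x ≠ d l → (x ∈ S₁' ↔ x ∈ S')) →
        ((∃ l' ∈ s, a l' ∈ S₁ ∧ b l' ∈ S₁ ∧ d l' ∈ S₁') ↔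
          ∃ l' ∈ s, a l' ∈ S ∧ b l' ∈ S ∧ d l' ∈ S') := by
      intro S S₁ S' S₁' h1 h2
      refine exists_congr fun l' => and_congr_right fun hl' => ?_
      rw [h1 _ (na l' hl') (nab l' hl'), h1 _ (nba l' hl') (nb l' hl'), h2 _ (nd l' hl')]
    -- If `a l` or `b l` is missing, the triple of `l` fails whatever happens to `d l`.
    have hpart : ∀ S ⊆ E', ∀ S₁ : Finset α, (∀ x, x ≠ a l → x ≠ b l → (x ∈ S₁ ↔ x ∈ S)) →
        ¬ (a l ∈ S₁ ∧ b l ∈ S₁) → subsetExp q D (fun S' =>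
          if ∃ l' ∈ insert l s, a l' ∈ S₁ ∧ b l' ∈ S₁ ∧ d l' ∈ S' then (0 : ℝ) else 1) =
        subsetExp q D' (fun S' =>
          if ∃ l' ∈ s, a l' ∈ S ∧ b l' ∈ S ∧ d l' ∈ S' then (0 : ℝ) else 1) := by
      intro S hS S₁ h1 h2
      rw [hD, subsetExp_insert q hdD']
      have e1 : ∀ S₁' S' : Finset β, (∀ x, x ≠ d l → (x ∈ S₁' ↔ x ∈ S')) →
          ((∃ l' ∈ insert l s, a l' ∈ S₁ ∧ b l' ∈ S₁ ∧ d l' ∈ S₁') ↔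
            ∃ l' ∈ s, a l' ∈ S ∧ b l' ∈ S ∧ d l' ∈ S') := by
        intro S₁' S' h3
        rw [hins, hex S S₁ S' S₁' h1 h3, or_iff_right]
        exact fun h => h2 ⟨h.1, h.2.1⟩
      have k1 : subsetExp q D' (fun S' => if ∃ l' ∈ insert l s, a l' ∈ S₁ ∧ b l' ∈ S₁ ∧
          d l' ∈ S' then (0 : ℝ) else 1) = subsetExp q D' (fun S' =>
          if ∃ l' ∈ s, a l' ∈ S ∧ b l' ∈ S ∧ d l' ∈ S' then (0 : ℝ) else 1) :=
        subsetExp_congr fun S' _ => if_congr (e1 S' S' fun x _ => Iff.rfl) rfl rfl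
      have k2 : subsetExp q D' (fun S' => if ∃ l' ∈ insert l s, a l' ∈ S₁ ∧ b l' ∈ S₁ ∧
          d l' ∈ insert (d l) S' then (0 : ℝ) else 1) = subsetExp q D' (fun S' =>
          if ∃ l' ∈ s, a l' ∈ S ∧ b l' ∈ S ∧ d l' ∈ S' then (0 : ℝ) else 1) :=
        subsetExp_congr fun S' _ => if_congr (e1 _ S' fun x hx => by simp [hx]) rfl rfl
      rw [k1, k2]
      ring
    -- If both are present, `d l` has to be missing, which costs the factor `1 - q`. Together the
    -- cases give `p ^ 2 * (1 - q) + (1 - p ^ 2) = 1 - p ^ 2 * q`.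
    have hfull : ∀ S ⊆ E', subsetExp q D (fun S' =>
          if ∃ l' ∈ insert l s, a l' ∈ insert (a l) (insert (b l) S) ∧
            b l' ∈ insert (a l) (insert (b l) S) ∧ d l' ∈ S' then (0 : ℝ) else 1) =
        (1 - q) * subsetExp q D' (fun S' =>
          if ∃ l' ∈ s, a l' ∈ S ∧ b l' ∈ S ∧ d l' ∈ S' then (0 : ℝ) else 1) := by
      intro S hS
      rw [hD, subsetExp_insert q hdD']
      have e1 : subsetExp q D' (fun S' =>
          if ∃ l' ∈ insert l s, a l' ∈ insert (a l) (insert (b l) S) ∧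
            b l' ∈ insert (a l) (insert (b l) S) ∧ d l' ∈ insert (d l) S' then (0 : ℝ) else 1) =
          0 := by
        refine Eq.trans (subsetExp_congr (F' := fun _ => 0) fun S' _ => ?_)
          (subsetExp_const q 0 D')
        refine if_pos ?_
        exact ⟨l, hls, by simp⟩
      rw [e1, mul_zero, zero_add]
      congr 1
      refine subsetExp_congr fun S' hS' => ?_
      have e2 : ((∃ l' ∈ insert l s, a l' ∈ insert (a l) (insert (b l) S) ∧
          b l' ∈ insert (a l) (insert (b l) S) ∧ d l' ∈ S') ↔
          ∃ l' ∈ s, a l' ∈ S ∧ b l' ∈ S ∧ d l' ∈ S') := by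
        rw [hins, hex S _ S' S' (fun x h1 h2 => by simp [h1, h2]) fun x _ => Iff.rfl, or_iff_right]
        exact fun h => hdD' (hS' h.2.2)
      exact if_congr e2 rfl rfl
    rw [hE, subsetExp_insert p haE', subsetExp_insert p hbE', subsetExp_insert p hbE',
      Finset.card_insert_of_notMem hl, pow_succ, ← hih]
    have t1 := subsetExp_congr (p := p) hfull
    have t2 := subsetExp_congr (p := p) fun S hS =>
      hpart S hS (insert (a l) S) (fun x h1 _ => by simp [h1]) (by
        rintro ⟨-, h⟩
        rcases Finset.mem_insert.1 h with h | h
        · exact nab0 h.symm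
        · exact hbE' (hS h))
    have t3 := subsetExp_congr (p := p) fun S hS =>
      hpart S hS (insert (b l) S) (fun x _ h2 => by simp [h2]) (by
        rintro ⟨h, -⟩
        rcases Finset.mem_insert.1 h with h | h
        · exact nab0 h
        · exact haE'' (hS h))
    have t4 := subsetExp_congr (p := p) fun S hS =>
      hpart S hS S (fun x _ _ => Iff.rfl) (fun h => hbE' (hS h.2))
    rw [t1, t2, t3, t4, subsetExp_const_mul]
    ring

end

theorem sideInfoExp_eq {K : ℕ} (G : SimpleGraph (Fin K)) (pS pD : ℝ)
    (F : Finset (Sym2 (Fin K)) → Finset (Sym2 (Fin K)) → ℝ) :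
    sideInfoExp G pS pD F =
      subsetExp pS (edges G) fun ES => subsetExp pD (edges Gᶜ) fun ED => F ES ED := by
  unfold sideInfoExp subsetExp
  refine Finset.sum_congr rfl fun ES _ => ?_
  rw [Finset.mul_sum]
  refine Finset.sum_congr rfl fun ED _ => ?_
  ring

/-! ### Classes of the unit interval graph -/

section
variable {K : ℕ} {ε : ℝ} {μ : Fin K → ℝ}

theorem mem_edges {G : SimpleGraph (Fin K)} {i j : Fin K} : s(i, j) ∈ edges G ↔ G.Adj i j := by
  simp [edges]

theorem mem_closedNbhd_uig (hε : 0 < ε) {i j : Fin K} :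
    j ∈ closedNbhd (uig ε μ) i ↔ |μ i - μ j| < ε := by
  unfold closedNbhd uig
  simp only [Set.mem_ofPred_eq]
  constructor
  · rintro (rfl | h)
    · simpa using hε
    · exact h.2
  · intro h
    by_cases hij : j = i
    · exact Or.inl hij
    · exact Or.inr ⟨fun h => hij h.symm, h⟩

theorem mem_nbhdClass {G : SimpleGraph (Fin K)} {i j : Fin K} :
    j ∈ nbhdClass G i ↔ closedNbhd G j = closedNbhd G i := by
  simp [nbhdClass]

theorem mem_nbhdClass_self (G : SimpleGraph (Fin K)) (i : Fin K) : i ∈ nbhdClass G i :=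
  mem_nbhdClass.2 rfl

theorem near_iff_of_mem (hε : 0 < ε) {i j : Fin K} (h : j ∈ nbhdClass (uig ε μ) i) (k : Fin K) :
    |μ j - μ k| < ε ↔ |μ i - μ k| < ε := by
  rw [← mem_closedNbhd_uig hε, ← mem_closedNbhd_uig hε, mem_nbhdClass.1 h]

theorem mem_nbhdClass_of_near_iff (hε : 0 < ε) {i j : Fin K}
    (h : ∀ k, |μ j - μ k| < ε ↔ |μ i - μ k| < ε) : j ∈ nbhdClass (uig ε μ) i := by
  rw [mem_nbhdClass]
  ext k
  rw [mem_closedNbhd_uig hε, mem_closedNbhd_uig hε, h k]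

theorem near_of_mem_class (hε : 0 < ε) {i a b : Fin K} (ha : a ∈ nbhdClass (uig ε μ) i)
    (hb : b ∈ nbhdClass (uig ε μ) i) : |μ a - μ b| < ε := by
  rw [near_iff_of_mem hε ha, abs_sub_comm, near_iff_of_mem hε hb]
  simpa using hε

/-- An arm whose mean lies between those of `imin` and of a member of its class has the same
neighbours as `imin`. A different class therefore lies entirely above. -/
theorem classLT_min (hε : 0 < ε) {imin i : Fin K} (hmin : ∀ j, μ imin ≤ μ j)
    (hi : i ∉ nbhdClass (uig ε μ) imin) : ClassLT (uig ε μ) μ imin i := by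
  intro a ha b hb
  by_contra hc
  refine hi ?_
  have h1 : b ∈ nbhdClass (uig ε μ) imin := by
    refine mem_nbhdClass_of_near_iff hε fun k => ?_
    have hak := near_iff_of_mem hε ha k
    have ham := near_of_mem_class hε ha (mem_nbhdClass_self _ imin)
    have := hmin k
    have := hmin b
    rw [abs_lt] at ham
    constructor
    · intro h
      rw [← hak, abs_lt]
      rw [abs_lt] at h
      constructor <;> linarith
    · intro h
      rw [abs_lt] at h ⊢
      constructor <;> linarith
  rw [mem_nbhdClass] at *
  exact hb.symm.trans h1

theorem classLT_max (hε : 0 < ε) {imax i : Fin K} (hmax : ∀ j, μ j ≤ μ imax)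
    (hi : i ∉ nbhdClass (uig ε μ) imax) : ClassLT (uig ε μ) μ i imax := by
  intro b hb a ha
  by_contra hc
  refine hi ?_
  have h1 : b ∈ nbhdClass (uig ε μ) imax := by
    refine mem_nbhdClass_of_near_iff hε fun k => ?_
    have hak := near_iff_of_mem hε ha k
    have ham := near_of_mem_class hε ha (mem_nbhdClass_self _ imax)
    have := hmax k
    have := hmax b
    rw [abs_lt] at ham
    constructor
    · intro h
      rw [← hak, abs_lt]
      rw [abs_lt] at h
      constructor <;> linarith
    · intro h
      rw [abs_lt] at h ⊢
      constructor <;> linarith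
  rw [mem_nbhdClass] at *
  exact hb.symm.trans h1

theorem near_of_mem_sim {ES : Finset (Sym2 (Fin K))} (hES : ES ⊆ edges (uig ε μ))
    (i j : Fin K) (h : s(i, j) ∈ ES) : |μ i - μ j| < ε :=
  (mem_edges.1 (hES h)).2

/-- No two neighbours can be revealed as dissimilar when the neighbourhood is a clique. This applies
to the two extreme classes. -/
theorem class_subset_remaining (hε : 0 < ε) {ES ED : Finset (Sym2 (Fin K))}
    (hES : ES ⊆ edges (uig ε μ)) (hED : ED ⊆ edges (uig ε μ)ᶜ) {i : Fin K}
    (hclique : ∀ j k, |μ i - μ j| < ε → |μ i - μ k| < ε → |μ j - μ k| < ε) :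
    nbhdClass (uig ε μ) i ⊆ remaining ES ED := by
  intro a ha
  unfold remaining
  rw [Finset.mem_filter]
  refine ⟨Finset.mem_univ _, ?_⟩
  rintro ⟨j, k, hj, hk, hjk⟩
  have h1 := (near_iff_of_mem hε ha j).1 (near_of_mem_sim hES a j hj)
  have h2 := (near_iff_of_mem hε ha k).1 (near_of_mem_sim hES a k hk)
  have h3 := mem_edges.1 (hED hjk)
  rw [SimpleGraph.compl_adj] at h3
  exact h3.2 ⟨h3.1, hclique j k h1 h2⟩

theorem clique_max {imax : Fin K} (hmax : ∀ j, μ j ≤ μ imax) (j k : Fin K)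
    (h1 : |μ imax - μ j| < ε) (h2 : |μ imax - μ k| < ε) : |μ j - μ k| < ε := by
  have := hmax j
  have := hmax k
  rw [abs_lt] at *
  constructor <;> linarith

theorem clique_min {imin : Fin K} (hmin : ∀ j, μ imin ≤ μ j) (j k : Fin K)
    (h1 : |μ imin - μ j| < ε) (h2 : |μ imin - μ k| < ε) : |μ j - μ k| < ε := by
  have := hmin j
  have := hmin k
  rw [abs_lt] at *
  constructor <;> linarith

/-! ### Offline elimination -/

/-- Arms of one class have the same neighbours, so a single edge between two classes brings all of
them. -/
theorem adj_of_classAdj (hε : 0 < ε) {i j : Fin K} (h : ClassAdj (uig ε μ) i j) {a b : Fin K}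
    (ha : a ∈ nbhdClass (uig ε μ) i) (hb : b ∈ nbhdClass (uig ε μ) j) : |μ a - μ b| < ε := by
  obtain ⟨a', ha', b', hb', hadj⟩ := h
  rw [near_iff_of_mem hε ha, ← near_iff_of_mem hε ha', abs_sub_comm, near_iff_of_mem hε hb,
    ← near_iff_of_mem hε hb', abs_sub_comm]
  exact hadj.2

open Classical in
/-- An arm of an intermediate class survives the offline step with small probability. -/
theorem prob_remaining_le (hε : 0 < ε) {pS pD c : ℝ} (hpS : 0 ≤ pS ∧ pS ≤ 1)
    (hpD : 0 ≤ pD ∧ pD ≤ 1) (hdiv : Diverse (uig ε μ) μ)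
    (hc : ∀ i, c ≤ ((nbhdClass (uig ε μ) i).card : ℝ)) {q : ℝ} (hq : 0 ≤ q)
    (hprob : 1 - Real.exp (-q) ≤ pS ^ 2 * pD) {i a b : Fin K}
    (ha : ClassLT (uig ε μ) μ a i) (hb : ClassLT (uig ε μ) μ i b) :
    subsetExp pS (edges (uig ε μ)) (fun ES => subsetExp pD (edges (uig ε μ)ᶜ) fun ED =>
      if i ∈ remaining ES ED then 1 else 0) ≤ Real.exp (-(q * c)) := by
  obtain ⟨j, k, hji, hik, aji, aki, njk⟩ := hdiv i ⟨a, ha⟩ ⟨b, hb⟩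
  set G := uig ε μ with hG
  have hii := mem_nbhdClass_self G i
  -- Equally many arms are taken from the lower and the higher class and matched in order.
  obtain ⟨J, hJsub, hJcard⟩ := Finset.exists_subset_card_eq
    (min_le_left (nbhdClass G j).card (nbhdClass G k).card)
  obtain ⟨L, hLsub, hLcard⟩ := Finset.exists_subset_card_eq
    (min_le_right (nbhdClass G j).card (nbhdClass G k).card)
  set n := min (nbhdClass G j).card (nbhdClass G k).card with hn
  let fJ := J.orderEmbOfFin hJcard
  let fL := L.orderEmbOfFin hLcard
  have hJm : ∀ l, fJ l ∈ nbhdClass G j := fun l => hJsub (J.orderEmbOfFin_mem hJcard l)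
  have hLm : ∀ l, fL l ∈ nbhdClass G k := fun l => hLsub (L.orderEmbOfFin_mem hLcard l)
  have hlt1 : ∀ l, μ (fJ l) < μ i := fun l => hji _ (hJm l) _ hii
  have hlt2 : ∀ l, μ i < μ (fL l) := fun l => hik _ hii _ (hLm l)
  have hne1 : ∀ l, fJ l ≠ i := fun l h => absurd (hlt1 l) (by rw [h]; exact lt_irrefl _)
  have hne2 : ∀ l, fL l ≠ i := fun l h => absurd (hlt2 l) (by rw [h]; exact lt_irrefl _)
  have hne3 : ∀ l l', fJ l ≠ fL l' := fun l l' h => by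
    have := hlt1 l; have := hlt2 l'; rw [h] at *; linarith
  -- The `l`-th triple consists of the edges from `i` to the `l`-th arms of both sides and of the
  -- non-edge between these arms; different triples share no pair.
  have key := subsetExp_triples pS pD (Finset.univ : Finset (Fin n)) (fun l => s(i, fJ l))
    (fun l => s(i, fL l)) (fun l => s(fJ l, fL l))
    (fun l _ l' _ h => by
      rcases Sym2.eq_iff.1 h with h | h
      · exact fJ.injective h.2
      · exact absurd h.1.symm (hne1 l'))
    (fun l _ l' _ h => by
      rcases Sym2.eq_iff.1 h with h | h
      · exact fL.injective h.2
      · exact absurd h.1.symm (hne2 l'))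
    (fun l _ l' _ h => by
      rcases Sym2.eq_iff.1 h with h | h
      · exact fJ.injective h.1
      · exact absurd h.1 (hne3 l l'))
    (fun l _ l' _ h => by
      rcases Sym2.eq_iff.1 h with h | h
      · exact hne3 l l' h.2
      · exact hne2 l' h.1.symm)
    (edges G) (edges Gᶜ)
    (fun l _ => mem_edges.2 ⟨(hne1 l).symm, by
      rw [abs_sub_comm]; exact adj_of_classAdj hε aji (hJm l) hii⟩)
    (fun l _ => mem_edges.2 ⟨(hne2 l).symm, by
      rw [abs_sub_comm]; exact adj_of_classAdj hε aki (hLm l) hii⟩)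
    (fun l _ => by
      rw [mem_edges, SimpleGraph.compl_adj]
      exact ⟨hne3 l l, fun h => njk ⟨_, hJm l, _, hLm l, h⟩⟩)
  calc _ ≤ subsetExp pS (edges G) (fun ES => subsetExp pD (edges Gᶜ) fun ED =>
        if ∃ l ∈ (Finset.univ : Finset (Fin n)), s(i, fJ l) ∈ ES ∧ s(i, fL l) ∈ ES ∧
          s(fJ l, fL l) ∈ ED then 0 else 1) := by
        refine subsetExp_mono hpS fun ES _ => subsetExp_mono hpD fun ED _ => ?_
        by_cases h : ∃ l ∈ (Finset.univ : Finset (Fin n)), s(i, fJ l) ∈ ES ∧ s(i, fL l) ∈ ES ∧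
          s(fJ l, fL l) ∈ ED
        · obtain ⟨l, -, h1, h2, h3⟩ := h
          have : i ∉ remaining ES ED := by
            unfold remaining
            rw [Finset.mem_filter]
            exact fun h => h.2 ⟨_, _, h1, h2, h3⟩
          rw [if_neg this]
          split_ifs <;> norm_num
        · rw [if_neg h]
          split_ifs <;> norm_num
    _ = (1 - pS ^ 2 * pD) ^ n := by
        refine Eq.trans (subsetExp_congr fun ES _ => subsetExp_congr fun ED _ => ?_)
          (key.trans (by simp))
        congr
    _ ≤ Real.exp (-q) ^ n := by
        refine pow_le_pow_left₀ ?_ (by linarith) n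
        have h1 : pS ^ 2 ≤ 1 := pow_le_one₀ hpS.1 hpS.2
        have := mul_le_one₀ h1 hpD.1 hpD.2
        linarith
    _ = Real.exp (-(q * n)) := by rw [← Real.exp_nat_mul]; congr 1; ring
    _ ≤ _ := by
        refine Real.exp_le_exp.2 ?_
        have : c ≤ n := by
          rw [hn]; push_cast
          exact le_min (hc j) (hc k)
        have := mul_le_mul_of_nonneg_left this hq
        linarith

/-! ### The value of the linear program -/

/-- The number of neighbours of `i` in `Q` that are revealed as similar. -/
def simDegree (Q : Finset (Fin K)) (ES : Finset (Sym2 (Fin K))) (i : Fin K) : ℕ :=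
  ((Q.erase i).filter fun j => s(i, j) ∈ ES).card

open Classical in
/-- The arms of `Q` with few revealed neighbours in `Q`. -/
def lowDegree (p : ℝ) (Q : Finset (Fin K)) (ES : Finset (Sym2 (Fin K))) : Finset (Fin K) :=
  Q.filter fun i => (simDegree Q ES i : ℝ) + 1 < p / 4 * Q.card

open Classical in
/-- Exploration values that cover `Q`. -/
def coverValue (p : ℝ) (Q : Finset (Fin K)) (ES : Finset (Sym2 (Fin K))) (i : Fin K) : ℝ :=
  (if i ∈ Q then 1 / (p / 4 * Q.card) else 0) + if i ∈ lowDegree p Q ES then 1 else 0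

theorem coverValue_nonneg {p : ℝ} (hp : 0 ≤ p) (Q : Finset (Fin K)) (ES : Finset (Sym2 (Fin K)))
    (i : Fin K) : 0 ≤ coverValue p Q ES i := by
  unfold coverValue
  refine add_nonneg ?_ ?_ <;> split_ifs <;> positivity

/-- An arm of low degree covers itself; any other has at least `p / 4 * Q.card` arms in its closed
neighbourhood within `Q`, each with weight the inverse of this number. -/
theorem one_le_sum_coverValue {p : ℝ} (hp : 0 < p) {Q : Finset (Fin K)}
    {ES ED : Finset (Sym2 (Fin K))} (hQ : Q ⊆ remaining ES ED) {i : Fin K} (hi : i ∈ Q) :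
    1 ≤ ∑ j ∈ simNbhd ES ED i, coverValue p Q ES j := by
  classical
  have hnn := fun j => coverValue_nonneg hp.le Q ES j
  have hself : i ∈ simNbhd ES ED i := by
    unfold simNbhd
    exact Finset.mem_filter.2 ⟨hQ hi, Or.inl rfl⟩
  have hcard : 0 < Q.card := Finset.card_pos.2 ⟨i, hi⟩
  have hc : (0 : ℝ) < p / 4 * Q.card := by positivity
  by_cases hlow : i ∈ lowDegree p Q ES
  · refine le_trans ?_ (Finset.single_le_sum (f := coverValue p Q ES) (fun j _ => hnn j) hself)
    unfold coverValue
    rw [if_pos hlow, if_pos hi]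
    have : 0 ≤ 1 / (p / 4 * Q.card) := by positivity
    linarith
  · set N := insert i ((Q.erase i).filter fun j => s(i, j) ∈ ES) with hN
    have hNsub : N ⊆ simNbhd ES ED i := by
      intro j hj
      rcases Finset.mem_insert.1 hj with rfl | hj
      · exact hself
      · obtain ⟨h1, h2⟩ := Finset.mem_filter.1 hj
        unfold simNbhd
        exact Finset.mem_filter.2 ⟨hQ (Finset.mem_of_mem_erase h1), Or.inr h2⟩
    have hNQ : ∀ j ∈ N, j ∈ Q := by
      intro j hj
      rcases Finset.mem_insert.1 hj with rfl | hj
      · exact hi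
      · exact Finset.mem_of_mem_erase (Finset.mem_filter.1 hj).1
    have hNcard : N.card = simDegree Q ES i + 1 := by
      rw [hN, Finset.card_insert_of_notMem (by simp)]; rfl
    have hge : p / 4 * Q.card ≤ (simDegree Q ES i : ℝ) + 1 := by
      by_contra h
      exact hlow (Finset.mem_filter.2 ⟨hi, not_le.1 h⟩)
    calc (1 : ℝ) ≤ N.card • (1 / (p / 4 * Q.card)) := by
          rw [nsmul_eq_mul, mul_one_div, le_div_iff₀ hc, one_mul, hNcard]
          push_cast; exact hge
      _ ≤ ∑ j ∈ N, coverValue p Q ES j := by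
          refine Finset.card_nsmul_le_sum _ _ _ fun j hj => ?_
          unfold coverValue
          rw [if_pos (hNQ j hj)]
          have : (0 : ℝ) ≤ if j ∈ lowDegree p Q ES then 1 else 0 := by split_ifs <;> simp
          linarith
      _ ≤ _ := Finset.sum_le_sum_of_subset_of_nonneg hNsub fun j _ _ => hnn j

theorem sum_coverValue_le {p : ℝ} (hp : 0 < p) {Q : Finset (Fin K)}
    {ES ED : Finset (Sym2 (Fin K))} (hQ : Q ⊆ remaining ES ED) :
    ∑ j ∈ remaining ES ED, coverValue p Q ES j ≤ 4 / p + (lowDegree p Q ES).card := by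
  classical
  have hlow : lowDegree p Q ES ⊆ remaining ES ED := (Finset.filter_subset _ _).trans hQ
  unfold coverValue
  rw [Finset.sum_add_distrib, Finset.sum_ite_mem, Finset.inter_eq_right.2 hQ, Finset.sum_ite_mem,
    Finset.inter_eq_right.2 hlow]
  simp only [Finset.sum_const, nsmul_eq_mul, mul_one]
  refine add_le_add ?_ le_rfl
  rcases Nat.eq_zero_or_pos Q.card with h | h
  · rw [h]; simp only [Nat.cast_zero, zero_mul]; positivity
  · have : (0 : ℝ) < Q.card := by exact_mod_cast h
    rw [mul_one_div, div_le_div_iff₀ (by positivity) hp]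
    exact le_of_eq (by ring)

/-- The arms that survive the offline step although their classes are intermediate. -/
def midRemaining (G : SimpleGraph (Fin K)) (imin imax : Fin K) (ES ED : Finset (Sym2 (Fin K))) :
    Finset (Fin K) := remaining ES ED \ (nbhdClass G imin ∪ nbhdClass G imax)

/-- The optimum is compared with a feasible point: weight `1` on every surviving intermediate arm
and `coverValue` on each extreme class. -/
theorem explorationValue_sum_le {G : SimpleGraph (Fin K)} {imin imax : Fin K} {p : ℝ} (hp : 0 < p)
    {ES ED : Finset (Sym2 (Fin K))} {z : Fin K → ℝ} (hz : IsExplorationValue ES ED z)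
    (hmin : nbhdClass G imin ⊆ remaining ES ED) (hmax : nbhdClass G imax ⊆ remaining ES ED) :
    ∑ i ∈ remaining ES ED, z i ≤ (midRemaining G imin imax ES ED).card +
      (4 / p + (lowDegree p (nbhdClass G imin) ES).card) +
      (4 / p + (lowDegree p (nbhdClass G imax) ES).card) := by
  classical
  have c1 := fun j => coverValue_nonneg hp.le (nbhdClass G imin) ES j
  have c2 := fun j => coverValue_nonneg hp.le (nbhdClass G imax) ES j
  have c3 : ∀ j, (0 : ℝ) ≤ if j ∈ midRemaining G imin imax ES ED then 1 else 0 := fun j => by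
    split_ifs <;> simp
  refine (hz.2 (fun i => (if i ∈ midRemaining G imin imax ES ED then 1 else 0) +
    coverValue p (nbhdClass G imin) ES i + coverValue p (nbhdClass G imax) ES i)
    ⟨fun i hi => ?_, fun i _ => add_nonneg (add_nonneg (c3 i) (c1 i)) (c2 i)⟩).trans ?_
  · rw [Finset.sum_add_distrib, Finset.sum_add_distrib]
    have s1 := Finset.sum_nonneg (s := simNbhd ES ED i) fun j _ => c1 j
    have s2 := Finset.sum_nonneg (s := simNbhd ES ED i) fun j _ => c2 j
    have s3 := Finset.sum_nonneg (s := simNbhd ES ED i) fun j _ => c3 j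
    by_cases h1 : i ∈ nbhdClass G imin
    · linarith [one_le_sum_coverValue (ED := ED) hp hmin h1]
    by_cases h2 : i ∈ nbhdClass G imax
    · linarith [one_le_sum_coverValue (ED := ED) hp hmax h2]
    have hself : i ∈ simNbhd ES ED i := by
      unfold simNbhd
      exact Finset.mem_filter.2 ⟨hi, Or.inl rfl⟩
    have hmid : i ∈ midRemaining G imin imax ES ED := by
      unfold midRemaining
      simp [hi, h1, h2]
    have := Finset.single_le_sum (f := fun j =>
      if j ∈ midRemaining G imin imax ES ED then (1 : ℝ) else 0) (fun j _ => c3 j) hself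
    simp only [hmid, if_true] at this
    linarith
  · rw [Finset.sum_add_distrib, Finset.sum_add_distrib]
    refine add_le_add (add_le_add ?_ (sum_coverValue_le hp hmin)) (sum_coverValue_le hp hmax)
    have hsub : midRemaining G imin imax ES ED ⊆ remaining ES ED := Finset.sdiff_subset
    rw [Finset.sum_ite_mem, Finset.inter_eq_right.2 hsub]
    simp

/-- Chernoff's bound: the degree has mean `p (n - 1)`, so it falls below `p n / 4 - 1` with
probability at most `exp (-(p n / 4))`. Summed over `n` arms, `x ≤ exp x` with `x = p n / 4` gives a
bound free of `n`. -/
theorem subsetExp_lowDegree_le {p : ℝ} (hp : 0 < p) (hp1 : p ≤ 1) (Q : Finset (Fin K))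
    (E : Finset (Sym2 (Fin K))) (hE : ∀ i ∈ Q, ∀ j ∈ Q, i ≠ j → s(i, j) ∈ E) :
    subsetExp p E (fun ES => ((lowDegree p Q ES).card : ℝ)) ≤ 4 / p := by
  classical
  set n := Q.card with hn
  have hterm : ∀ i ∈ Q, subsetExp p E (fun ES => if (simDegree Q ES i : ℝ) + 1 < p / 4 * n then
      (1 : ℝ) else 0) ≤ Real.exp (-(p / 4 * n)) := by
    intro i hi
    have hprod := subsetExp_prod p (Real.exp (-1)) (Q.erase i) (fun j => s(i, j))
      (fun j hj j' hj' h => by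
        rcases Sym2.eq_iff.1 h with h | h
        · exact h.2
        · exact absurd h.2 (Finset.ne_of_mem_erase hj)) E
      (fun j hj => hE i hi j (Finset.mem_of_mem_erase hj) (Finset.ne_of_mem_erase hj).symm)
    have hcard : ((Q.erase i).card : ℝ) = n - 1 := by
      rw [Finset.card_erase_of_mem hi, Nat.cast_sub (Finset.card_pos.2 ⟨i, hi⟩)]; simp [hn]
    have he : Real.exp (-1) ≤ 1 / 2 := by
      rw [Real.exp_neg, ← one_div]
      refine one_div_le_one_div_of_le (by norm_num) ?_
      have := Real.add_one_le_exp (1 : ℝ)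
      linarith
    have he0 := Real.exp_pos (-1)
    calc _ ≤ subsetExp p E (fun ES => Real.exp (p / 4 * n - 1) *
          ∏ j ∈ Q.erase i, if s(i, j) ∈ ES then Real.exp (-1) else 1) := by
          refine subsetExp_mono ⟨hp.le, hp1⟩ fun ES _ => ?_
          have hdeg : (∏ j ∈ Q.erase i, if s(i, j) ∈ ES then Real.exp (-1) else 1) =
              Real.exp (-(simDegree Q ES i : ℝ)) := by
            rw [Finset.prod_ite, Finset.prod_const_one, mul_one, Finset.prod_const,
              ← Real.exp_nat_mul]
            congr 1
            unfold simDegree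
            ring
          rw [hdeg, ← Real.exp_add]
          split_ifs with h
          · exact Real.one_le_exp (by linarith)
          · exact (Real.exp_pos _).le
      _ = Real.exp (p / 4 * n - 1) * (1 - p * (1 - Real.exp (-1))) ^ (Q.erase i).card := by
          rw [subsetExp_const_mul, hprod]
      _ ≤ Real.exp (p / 4 * n - 1) * Real.exp (-(p / 2)) ^ (Q.erase i).card := by
          refine mul_le_mul_of_nonneg_left (pow_le_pow_left₀ ?_ ?_ _) (Real.exp_pos _).le
          · nlinarith
          · have := Real.add_one_le_exp (-(p / 2))
            nlinarith
      _ = Real.exp (p / 4 * n - 1 - p / 2 * (n - 1)) := by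
          rw [← Real.exp_nat_mul, ← Real.exp_add, hcard]
          congr 1; ring
      _ ≤ _ := Real.exp_le_exp.2 (by nlinarith)
  have hcount : ∀ ES, ((lowDegree p Q ES).card : ℝ) =
      ∑ i ∈ Q, if (simDegree Q ES i : ℝ) + 1 < p / 4 * n then (1 : ℝ) else 0 := by
    intro ES
    rw [Finset.sum_boole]
    unfold lowDegree
    congr
  simp only [hcount]
  rw [subsetExp_sum]
  refine (Finset.sum_le_sum hterm).trans ?_
  rw [Finset.sum_const, nsmul_eq_mul, Real.exp_neg, ← div_eq_mul_inv,
    div_le_div_iff₀ (Real.exp_pos _) hp]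
  have := Real.add_one_le_exp (p / 4 * n)
  rw [← hn]
  linarith

end

/-! ### Large horizons -/

/-- If all positive gaps were larger than `ε`, no edge would lead from the best arms to the others.
-/
theorem le_eps_of_connected {K : ℕ} {ε δ : ℝ} {μ : Fin K → ℝ} {imax i : Fin K}
    (hgap : ∀ j, μ j < μ imax → δ ≤ μ imax - μ j) (hmax : ∀ j, μ j ≤ μ imax)
    (hconn : (uig ε μ).Connected) (hi : μ i < μ imax) : δ ≤ ε := by
  by_contra hc
  have key : ∀ v, Relation.ReflTransGen (uig ε μ).Adj imax v → μ v = μ imax := by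
    intro v hv
    induction hv with
    | refl => rfl
    | tail _ hadj ih =>
      rename_i b c _
      rcases (hmax c).lt_or_eq with h | h
      · have h1 := hgap c h
        have h2 := (abs_lt.1 hadj.2).2
        rw [ih] at h2
        linarith
      · exact h
  have := key i ((SimpleGraph.reachable_iff_reflTransGen _ _).1 (hconn.preconnected imax i))
  linarith

/-- The index of the last epoch for large horizons. -/
def finalEpoch (ε lam : ℝ) : ℕ := ⌈Real.logb 2 (8 / (Real.sqrt (2 * lam) * ε))⌉₊

theorem gapEst_eq_inv (m : ℕ) : gapEst m = ((2 : ℝ) ^ m)⁻¹ := by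
  unfold gapEst; rw [one_div, inv_pow]

/-- The hypothesis on `T` says exactly that the cap by the horizon is inactive. -/
theorem lastEpoch_eq {ε lam : ℝ} {T : ℕ}
    (hT : Real.exp 1 ≤ T * gapEst (finalEpoch ε lam) ^ 2) :
    lastEpoch ε lam T = finalEpoch ε lam := by
  unfold lastEpoch
  refine min_eq_left ?_
  change finalEpoch ε lam ≤ _
  refine Nat.le_floor ?_
  have he := Real.exp_pos 1
  have h2 : (2 : ℝ) ^ ((2 * finalEpoch ε lam : ℕ) : ℝ) ≤ T / Real.exp 1 := by
    rw [Real.rpow_natCast, le_div_iff₀ he, mul_comm]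
    rw [gapEst_eq_inv, inv_pow, ← div_eq_mul_inv, le_div_iff₀ (by positivity), ← pow_mul] at hT
    rw [mul_comm 2]
    exact hT
  have h3 : ((2 * finalEpoch ε lam : ℕ) : ℝ) ≤ Real.logb 2 (T / Real.exp 1) :=
    (Real.le_logb_iff_rpow_le (by norm_num) (lt_of_lt_of_le (by positivity) h2)).2 h2
  push_cast at h3
  linarith

/-- The constant `8` even yields `ε / 8`. -/
theorem finalEpoch_acc {ε lam : ℝ} (hε : 0 < ε) (hlam : 0 < lam) :
    gapEst (finalEpoch ε lam) / Real.sqrt (2 * lam) ≤ ε / 4 := by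
  have hs : 0 < Real.sqrt (2 * lam) := Real.sqrt_pos.2 (by positivity)
  have h1 : Real.logb 2 (8 / (Real.sqrt (2 * lam) * ε)) ≤ finalEpoch ε lam := Nat.le_ceil _
  rw [Real.logb_le_iff_le_rpow (by norm_num) (by positivity), Real.rpow_natCast,
    div_le_iff₀ (by positivity)] at h1
  rw [gapEst_eq_inv, div_le_iff₀ hs, inv_le_iff_one_le_mul₀ (by positivity)]
  nlinarith

theorem inv_gapEst_finalEpoch_le {ε lam δ : ℝ} (hδ : 0 < δ) (hδε : δ ≤ ε) (hlam : 0 < lam) :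
    1 / gapEst (finalEpoch ε lam) ^ 2 ≤ 1 + 128 / (lam * δ ^ 2) := by
  have hε := hδ.trans_le hδε
  have hs : 0 < Real.sqrt (2 * lam) := Real.sqrt_pos.2 (by positivity)
  have hB : 0 ≤ 128 / (lam * δ ^ 2) := by positivity
  rw [gapEst_eq_inv, inv_pow, one_div, inv_inv]
  -- The summand `1` is for a vanishing index, where `⌈·⌉₊` truncates nonpositive values. Otherwise
  -- rounding up at most doubles `8 / (√(2 lam) ε)`, and `16 ^ 2 / 2 = 128`.
  rcases Nat.eq_zero_or_pos (finalEpoch ε lam) with h | h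
  · rw [h]; simpa using hB
  · have hpos : 0 < Real.logb 2 (8 / (Real.sqrt (2 * lam) * ε)) := Nat.ceil_pos.1 h
    have h1 : (finalEpoch ε lam : ℝ) < Real.logb 2 (8 / (Real.sqrt (2 * lam) * ε)) + 1 :=
      Nat.ceil_lt_add_one hpos.le
    have h2 : (2 : ℝ) ^ (finalEpoch ε lam) ≤ 16 / (Real.sqrt (2 * lam) * ε) := by
      rw [← Real.rpow_natCast]
      calc (2 : ℝ) ^ (finalEpoch ε lam : ℝ) ≤
            2 ^ (Real.logb 2 (8 / (Real.sqrt (2 * lam) * ε)) + 1) :=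
            Real.rpow_le_rpow_of_exponent_le (by norm_num) h1.le
        _ = 8 / (Real.sqrt (2 * lam) * ε) * 2 := by
            rw [Real.rpow_add (by norm_num), Real.rpow_logb (by norm_num) (by norm_num)
              (by positivity), Real.rpow_one]
        _ = _ := by ring
    calc ((2 : ℝ) ^ finalEpoch ε lam) ^ 2 ≤ (16 / (Real.sqrt (2 * lam) * ε)) ^ 2 :=
          pow_le_pow_left₀ (by positivity) h2 2
      _ = 128 / (lam * ε ^ 2) := by
          rw [div_pow, mul_pow, Real.sq_sqrt (by positivity)]
          field_simp; norm_num
      _ ≤ 128 / (lam * δ ^ 2) := by gcongr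
      _ ≤ _ := by linarith

/-- A crude bound that ensures that exploration fits into the horizon for large `T`. -/
theorem explorationValue_sum_le_card {K : ℕ} {ES ED : Finset (Sym2 (Fin K))} {z : Fin K → ℝ}
    (hz : IsExplorationValue ES ED z) : ∑ i ∈ remaining ES ED, z i ≤ K := by
  refine (hz.2 (fun _ => 1) ⟨fun i hi => ?_, fun _ _ => zero_le_one⟩).trans ?_
  · have hself : i ∈ simNbhd ES ED i := by
      unfold simNbhd
      exact Finset.mem_filter.2 ⟨hi, Or.inl rfl⟩
    exact Finset.single_le_sum (f := fun _ => (1 : ℝ)) (fun _ _ => zero_le_one) hself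
  · have : (remaining ES ED).card ≤ K := by simpa using Finset.card_le_univ (remaining ES ED)
    simp only [Finset.sum_const, nsmul_eq_mul, mul_one]
    exact_mod_cast this

theorem sum_target_le {K : ℕ} {lam B : ℝ} {T m : ℕ} {ES ED : Finset (Sym2 (Fin K))}
    {z : Fin K → ℝ} (hlam : 0 < lam) (hz : IsExplorationValue ES ED z)
    (hT : Real.exp 1 ≤ T * gapEst m ^ 2) (hB : 1 / gapEst m ^ 2 ≤ B) :
    ((∑ i ∈ remaining ES ED, target lam T z m i : ℕ) : ℝ) ≤
      lam * B * Real.log T * (∑ i ∈ remaining ES ED, z i) + K := by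
  have hg := gapEst_pos m
  have he : (1 : ℝ) ≤ Real.exp 1 := Real.one_le_exp zero_le_one
  have hg1 : gapEst m ^ 2 ≤ 1 := pow_le_one₀ hg.le
    (by have := gapEst_anti (Nat.zero_le m); simpa [gapEst] using this)
  have hT0 : (0 : ℝ) < T := by
    by_contra hc
    have h0 : (T : ℝ) ≤ 0 := not_lt.1 hc
    nlinarith [sq_nonneg (gapEst m)]
  have hlog : Real.log (T * gapEst m ^ 2) ≤ Real.log T :=
    Real.log_le_log (by positivity) (mul_le_of_le_one_right hT0.le hg1)
  have hlog0 : 0 ≤ Real.log (T * gapEst m ^ 2) := Real.log_nonneg (he.trans hT)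
  push_cast
  have hterm : ∀ i ∈ remaining ES ED, (target lam T z m i : ℝ) ≤
      lam * B * Real.log T * z i + 1 := by
    intro i hi
    have hzi := hz.1.2 i hi
    unfold target
    refine (Nat.ceil_lt_add_one (by positivity)).le.trans (add_le_add ?_ le_rfl)
    calc lam * z i * Real.log (T * gapEst m ^ 2) / gapEst m ^ 2
        = lam * z i * Real.log (T * gapEst m ^ 2) * (1 / gapEst m ^ 2) := by ring
      _ ≤ lam * z i * Real.log T * B := by gcongr
      _ = _ := by ring
  refine (Finset.sum_le_sum hterm).trans ?_
  rw [Finset.sum_add_distrib, ← Finset.mul_sum]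
  have : (remaining ES ED).card ≤ K := by simpa using Finset.card_le_univ (remaining ES ED)
  simp only [Finset.sum_const, nsmul_eq_mul, mul_one]
  have h2 : ((remaining ES ED).card : ℝ) ≤ K := by exact_mod_cast this
  linarith

theorem eventually_mul_log_add_le (a b : ℝ) :
    ∀ᶠ T : ℕ in atTop, a * Real.log T + b ≤ T := by
  have h : (fun x : ℝ => a * Real.log x + b) =o[atTop] (fun x : ℝ => x) :=
    (Real.isLittleO_log_id_atTop.const_mul_left a).add (Asymptotics.isLittleO_const_id_atTop b)
  filter_upwards [tendsto_natCast_atTop_atTop.eventually (h.def zero_lt_one)] with T hT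
  rw [one_mul, Real.norm_natCast] at hT
  exact (Real.le_norm_self _).trans hT

/-- The regret for given side information and a large horizon. -/
theorem regret_le_of_sideInfo {K : ℕ} {Ω : Type*} [MeasurableSpace Ω] {P : Measure Ω}
    [IsProbabilityMeasure P] {X : ℕ → Ω → Fin K → ℝ} {ε lam δ Δ p : ℝ} {T : ℕ}
    {ES ED : Finset (Sym2 (Fin K))} {μ : Fin K → ℝ} {imax imin : Fin K} {π : Policy K}
    (hX : IsRewards P X μ) (hε : 0 < ε) (hlam : 0 < lam) (hδ : 0 < δ) (hδε : δ ≤ ε) (hΔ : 0 ≤ Δ)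
    (hp : 0 < p) (hmax : ∀ j, μ j ≤ μ imax) (hmin : ∀ j, μ imin ≤ μ j)
    (hgap : ∀ i, μ i < μ imax → δ ≤ μ imax - μ i ∧ μ imax - μ i ≤ Δ)
    (hfar : ∀ i ∈ nbhdClass (uig ε μ) imin, 4 * ε < μ imax - μ i)
    (hES : ES ⊆ edges (uig ε μ)) (hED : ED ⊆ edges (uig ε μ)ᶜ)
    (hπ : IsLSDTPSI ε lam T ES ED π)
    (hT1 : Real.exp 1 ≤ T * gapEst (finalEpoch ε lam) ^ 2)
    (hT2 : lam * (1 + 128 / (lam * δ ^ 2)) * K * Real.log T + K ≤ T)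
    (hT3 : 1 ≤ Real.log T) :
    regret P X (μ imax) π T ≤
      Δ * (lam * (1 + 128 / (lam * δ ^ 2)) * Real.log T *
          ((midRemaining (uig ε μ) imin imax ES ED).card + 8 / p +
            (lowDegree p (nbhdClass (uig ε μ) imin) ES).card +
            (lowDegree p (nbhdClass (uig ε μ) imax) ES).card) +
        (K + (finalEpoch ε lam + 1) * (K * (2 / gapEst (finalEpoch ε lam) ^ 2))) +
        ((midRemaining (uig ε μ) imin imax ES ED).card +
          (nbhdClass (uig ε μ) imax \ optArms μ).card) * ((8 / δ ^ 2 + 5) * Real.log T)) := by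
  obtain ⟨z, hz, hOK⟩ := hπ.follows
  have hL := lastEpoch_eq hT1
  have hB := inv_gapEst_finalEpoch_le hδ hδε hlam
  have hB0 : 0 ≤ lam * (1 + 128 / (lam * δ ^ 2)) * Real.log T := by positivity
  have hsub1 := class_subset_remaining hε hES hED (clique_max hmax)
  have hsub2 := class_subset_remaining hε hES hED (clique_min hmin)
  have htar := sum_target_le hlam hz hT1 hB
  have hA : Admissible ε lam T ES ED z μ imax := by
    refine ⟨hε, hlam, near_of_mem_sim hES, hmax, hz.1, hsub1 (mem_nbhdClass_self _ _), ?_, ?_, ?_⟩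
    · rw [hL]; exact hT1
    · rw [hL]; exact finalEpoch_acc hε hlam
    · rw [hL]
      have h1 := explorationValue_sum_le_card hz
      have h2 := mul_le_mul_of_nonneg_left h1 hB0
      have h3 : ((∑ i ∈ remaining ES ED, target lam T z (finalEpoch ε lam) i : ℕ) : ℝ) ≤ T := by
        linarith
      exact_mod_cast h3
  -- The arms that may be played suboptimally at the end: the lowest class is excluded because its
  -- gaps exceed `4ε`.
  have hreg := hA.regret_le hX hπ.measurable hOK hδ hΔ hgap
    (midRemaining (uig ε μ) imin imax ES ED ∪ (nbhdClass (uig ε μ) imax \ optArms μ))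
    (fun i hi hlt h4 => by
      have hnmin : i ∉ nbhdClass (uig ε μ) imin := fun h => by linarith [hfar i h]
      rw [Finset.mem_union]
      by_cases h : i ∈ nbhdClass (uig ε μ) imax
      · right
        refine Finset.mem_sdiff.2 ⟨h, fun ho => ?_⟩
        simp only [optArms, Finset.mem_filter] at ho
        linarith [ho.2 imax]
      · left
        unfold midRemaining
        simp [hi, hnmin, h])
  refine hreg.trans (mul_le_mul_of_nonneg_left ?_ hΔ)
  rw [hL]
  have hzs := explorationValue_sum_le hp hz hsub2 hsub1
  have h1 := mul_le_mul_of_nonneg_left hzs hB0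
  have hcard : (((midRemaining (uig ε μ) imin imax ES ED ∪
      (nbhdClass (uig ε μ) imax \ optArms μ)).card : ℕ) : ℝ) ≤
      (midRemaining (uig ε μ) imin imax ES ED).card +
        (nbhdClass (uig ε μ) imax \ optArms μ).card := by
    exact_mod_cast Finset.card_union_le _ _
  have h2 : (8 / δ ^ 2 + 2) * Real.log T + 3 ≤ (8 / δ ^ 2 + 5) * Real.log T := by linarith
  have h3 : 0 ≤ (8 / δ ^ 2 + 2) * Real.log T + 3 := by positivity
  have h4 := mul_le_mul hcard h2 h3 (by positivity)
  have h5 : 8 / p = 4 / p + 4 / p := by ring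
  have h6 : lam * (1 + 128 / (lam * δ ^ 2)) * Real.log T *
      ((midRemaining (uig ε μ) imin imax ES ED).card +
      (4 / p + (lowDegree p (nbhdClass (uig ε μ) imin) ES).card) +
      (4 / p + (lowDegree p (nbhdClass (uig ε μ) imax) ES).card)) =
      lam * (1 + 128 / (lam * δ ^ 2)) * Real.log T *
          ((midRemaining (uig ε μ) imin imax ES ED).card + 8 / p +
            (lowDegree p (nbhdClass (uig ε μ) imin) ES).card +
            (lowDegree p (nbhdClass (uig ε μ) imax) ES).card) := by rw [h5]; ring
  linarith

/-- The expected number of intermediate arms that survive the offline step. -/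
theorem exp_midRemaining_le {K : ℕ} {ε : ℝ} {μ : Fin K → ℝ} {imax imin : Fin K} (hε : 0 < ε)
    {pS pD κ : ℝ} (hpS : 0 ≤ pS ∧ pS ≤ 1) (hpD : 0 ≤ pD ∧ pD ≤ 1) (hκ : 0 < κ)
    (hmax : ∀ j, μ j ≤ μ imax) (hmin : ∀ j, μ imin ≤ μ j) (hdiv : Diverse (uig ε μ) μ)
    (hc : ∀ i, κ * Real.log K ≤ ((nbhdClass (uig ε μ) i).card : ℝ))
    (hprob : 1 - Real.exp (-2 / κ) ≤ pS ^ 2 * pD) :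
    subsetExp pS (edges (uig ε μ)) (fun ES => subsetExp pD (edges (uig ε μ)ᶜ) fun ED =>
      ((midRemaining (uig ε μ) imin imax ES ED).card : ℝ)) ≤ 1 := by
  classical
  set G := uig ε μ with hG
  have hK : (1 : ℝ) ≤ K := by
    have : 0 < K := Fin.pos imax
    exact_mod_cast this
  have hcount : ∀ ES ED, ((midRemaining G imin imax ES ED).card : ℝ) =
      ∑ i ∈ Finset.univ \ (nbhdClass G imin ∪ nbhdClass G imax),
        if i ∈ remaining ES ED then (1 : ℝ) else 0 := by
    intro ES ED
    rw [Finset.sum_boole]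
    congr 2
    ext i
    simp only [midRemaining, Finset.mem_sdiff, Finset.mem_filter, Finset.mem_univ, true_and]
    exact and_comm
  simp only [hcount, subsetExp_sum]
  have hterm : ∀ i ∈ Finset.univ \ (nbhdClass G imin ∪ nbhdClass G imax),
      subsetExp pS (edges G) (fun ES => subsetExp pD (edges Gᶜ) fun ED =>
        if i ∈ remaining ES ED then (1 : ℝ) else 0) ≤ (K : ℝ)⁻¹ := by
    intro i hi
    simp only [Finset.mem_sdiff, Finset.mem_univ, true_and, Finset.mem_union, not_or] at hi
    -- With `q = 2 / κ` and `c = κ log K` the bound is `K⁻²`; already `K⁻¹` suffices for the sum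
    -- over at most `K` arms.
    have h := prob_remaining_le hε hpS hpD hdiv hc (q := 2 / κ) (by positivity)
      (by rw [← neg_div]; exact hprob) (classLT_min hε hmin hi.1) (classLT_max hε hmax hi.2)
    refine le_trans (le_of_eq ?_) (h.trans ?_)
    · refine subsetExp_congr fun ES _ => subsetExp_congr fun ED _ => ?_
      congr
    · have : 2 / κ * (κ * Real.log K) = 2 * Real.log K := by field_simp
      rw [this]
      calc Real.exp (-(2 * Real.log K)) ≤ Real.exp (-Real.log K) :=
            Real.exp_le_exp.2 (by linarith [Real.log_nonneg hK])
        _ = _ := by rw [Real.exp_neg, Real.exp_log (by linarith)]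
  refine (Finset.sum_le_card_nsmul _ _ _ hterm).trans ?_
  rw [nsmul_eq_mul]
  have hcard : ((Finset.univ \ (nbhdClass G imin ∪ nbhdClass G imax)).card : ℝ) ≤ K := by
    have : (Finset.univ \ (nbhdClass G imin ∪ nbhdClass G imax)).card ≤ K := by
      simpa using Finset.card_le_univ (Finset.univ \ (nbhdClass G imin ∪ nbhdClass G imax))
    exact_mod_cast this
  rw [← div_eq_mul_inv]
  exact div_le_one_of_le₀ hcard (by linarith)

end

end LSDT

/-! ### Averaging over the side information -/

theorem corollary1 (lam pS pD Δmin Δmax : ℝ) (hlam : 0 < lam)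
    (hpS : 0 ≤ pS ∧ pS ≤ 1) (hpD : 0 ≤ pD ∧ pD ≤ 1) (hΔ : 0 < Δmin) :
    -- the constant depends only on `lam`, `pS`, `pD` and on bounds for the positive gaps
    ∃ C : ℝ, ∀ (K : ℕ) (ε κ : ℝ) (f : Fin K → Measure ℝ) (μ : Fin K → ℝ) (imax imin : Fin K),
      0 < ε →
      -- reward distributions: means `μ i`, sub-Gaussian with parameter `1/2`
      (∀ i, IsProbabilityMeasure (f i)) →
      (∀ i, ∫ x, x ∂(f i) = μ i) →
      (∀ i, HasSubgaussianMGF (fun x => x - μ i) (1 / 4) (f i)) →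
      -- a best and a worst arm, and the bounds on the gaps
      (∀ j, μ j ≤ μ imax) →
      (∀ j, μ imin ≤ μ j) →
      (∀ i, μ i < μ imax → Δmin ≤ μ imax - μ i ∧ μ imax - μ i ≤ Δmax) →
      -- the structural assumptions on the graph
      (LSDT.uig ε μ).Connected →
      LSDT.Diverse (LSDT.uig ε μ) μ →
      0 < κ →
      (∀ i, κ * Real.log K ≤ ((LSDT.nbhdClass (LSDT.uig ε μ) i).card : ℝ)) →
      1 - Real.exp (-2 / κ) ≤ pS ^ 2 * pD →
      (∀ i ∈ LSDT.nbhdClass (LSDT.uig ε μ) imin, 4 * ε < μ imax - μ i) →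
      -- the rewards: independent over time, distributed as `f i` when arm `i` is played
      ∀ (Ω : Type*) [MeasurableSpace Ω] (P : Measure Ω) [IsProbabilityMeasure P]
        (X : ℕ → Ω → Fin K → ℝ),
        (∀ t, Measurable (X t)) →
        iIndepFun X P →
        (∀ t i, P.map (fun ω => X t ω i) = f i) →
        -- the policy, for every horizon and every realization of the side information
        ∀ π : ℕ → Finset (Sym2 (Fin K)) → Finset (Sym2 (Fin K)) → LSDT.Policy K,
          (∀ T ES ED, ES ⊆ LSDT.edges (LSDT.uig ε μ) → ED ⊆ LSDT.edges (LSDT.uig ε μ)ᶜ →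
            LSDT.IsLSDTPSI ε lam T ES ED (π T ES ED)) →
          ∀ᶠ T : ℕ in atTop,
            LSDT.sideInfoExp (LSDT.uig ε μ) pS pD
                (fun ES ED => LSDT.regret P X (μ imax) (π T ES ED) T) ≤
              C * (1 + ((LSDT.nbhdClass (LSDT.uig ε μ) imax \ LSDT.optArms μ).card : ℝ)) *
                Real.log T := by
  -- The summands stand for the exploration phase, for the terms that do not grow with `T`, and for
  -- the index phase per suboptimal arm.
  refine ⟨Δmax * (lam * (1 + 128 / (lam * Δmin ^ 2)) * (1 + 16 / pS) + 1 +
    (8 / Δmin ^ 2 + 5)), ?_⟩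
  intro K ε κ f μ imax imin hε _ hmean hsub hmax hmin hgap hconn hdiv hκ hc hprob hfar Ω _ P _ X
    hXm hind hmap π hπ
  have hX := LSDT.IsRewards.of_map hmean hsub hXm hind hmap
  have hlt : μ imin < μ imax := by
    have := hfar imin (LSDT.mem_nbhdClass_self _ _)
    linarith
  have hΔmax : 0 ≤ Δmax := by
    have := hgap imin hlt
    linarith
  have hδε := LSDT.le_eps_of_connected (fun j hj => (hgap j hj).1) hmax hconn hlt
  -- With `pS = 0` no triple could be revealed, against the positive lower bound on `pS ^ 2 * pD`.
  have hp : 0 < pS := by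
    rcases hpS.1.lt_or_eq with h | h
    · exact h
    · have : -2 / κ < 0 := div_neg_of_neg_of_pos (by norm_num) hκ
      rw [← h] at hprob
      norm_num at hprob
      linarith
  have hmid := LSDT.exp_midRemaining_le hε hpS hpD hκ hmax hmin hdiv hc hprob
  have hclass : ∀ i, LSDT.subsetExp pS (LSDT.edges (LSDT.uig ε μ)) (fun ES =>
      ((LSDT.lowDegree pS (LSDT.nbhdClass (LSDT.uig ε μ) i) ES).card : ℝ)) ≤ 4 / pS := fun i =>
    LSDT.subsetExp_lowDegree_le hp hpS.2 _ _ fun a ha b hb hab =>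
      LSDT.mem_edges.2 ⟨hab, LSDT.near_of_mem_class hε ha hb⟩
  have hg := LSDT.gapEst_pos (LSDT.finalEpoch ε lam)
  -- Rounding of the targets and failed estimates. It depends on `K` and `ε` but not on `T`, so `T`
  -- is taken so large that `c₀ ≤ log T`.
  set c₀ : ℝ := K + (LSDT.finalEpoch ε lam + 1) *
    (K * (2 / LSDT.gapEst (LSDT.finalEpoch ε lam) ^ 2)) with hc₀
  filter_upwards [
    (tendsto_natCast_atTop_atTop (R := ℝ)).eventually_ge_atTop
      (Real.exp 1 / LSDT.gapEst (LSDT.finalEpoch ε lam) ^ 2),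
    LSDT.eventually_mul_log_add_le (lam * (1 + 128 / (lam * Δmin ^ 2)) * K) K,
    (Real.tendsto_log_atTop.comp (tendsto_natCast_atTop_atTop (R := ℝ))).eventually_ge_atTop 1,
    (Real.tendsto_log_atTop.comp (tendsto_natCast_atTop_atTop (R := ℝ))).eventually_ge_atTop c₀]
    with T hT1 hT2 hT3 hT4
  rw [div_le_iff₀ (by positivity)] at hT1
  simp only [Function.comp] at hT3 hT4
  set A : ℝ := lam * (1 + 128 / (lam * Δmin ^ 2)) with hA
  set D : ℝ := 8 / Δmin ^ 2 + 5 with hD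
  set ν : ℝ := ((LSDT.nbhdClass (LSDT.uig ε μ) imax \ LSDT.optArms μ).card : ℝ) with hν
  have hA0 : 0 ≤ A := by positivity
  have hD0 : 0 ≤ D := by positivity
  have hν0 : 0 ≤ ν := Nat.cast_nonneg _
  have hl0 : 0 ≤ Real.log T := by linarith
  rw [LSDT.sideInfoExp_eq]
  set E := LSDT.edges (LSDT.uig ε μ) with hE
  set E' := LSDT.edges (LSDT.uig ε μ)ᶜ with hE'
  calc _ ≤ LSDT.subsetExp pS E (fun ES => LSDT.subsetExp pD E' fun ED =>
        (Δmax * (A + D) * Real.log T) *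
            ((LSDT.midRemaining (LSDT.uig ε μ) imin imax ES ED).card : ℝ) +
          (Δmax * (A * Real.log T * (8 / pS +
            (LSDT.lowDegree pS (LSDT.nbhdClass (LSDT.uig ε μ) imin) ES).card +
            (LSDT.lowDegree pS (LSDT.nbhdClass (LSDT.uig ε μ) imax) ES).card) + c₀ +
            ν * (D * Real.log T)))) := by
        refine LSDT.subsetExp_mono hpS fun ES hES => LSDT.subsetExp_mono hpD fun ED hED => ?_
        refine (LSDT.regret_le_of_sideInfo hX hε hlam hΔ hδε hΔmax hp hmax hmin hgap hfar hES hED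
          (hπ T ES ED hES hED) hT1 hT2 hT3).trans (le_of_eq ?_)
        ring
    _ = (Δmax * (A + D) * Real.log T) * LSDT.subsetExp pS E (fun ES => LSDT.subsetExp pD E' fun ED =>
            ((LSDT.midRemaining (LSDT.uig ε μ) imin imax ES ED).card : ℝ)) +
          (Δmax * (A * Real.log T * 8 / pS + c₀ + ν * (D * Real.log T)) +
          (Δmax * A * Real.log T * LSDT.subsetExp pS E (fun ES =>
            ((LSDT.lowDegree pS (LSDT.nbhdClass (LSDT.uig ε μ) imin) ES).card : ℝ)) +
          Δmax * A * Real.log T * LSDT.subsetExp pS E (fun ES =>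
            ((LSDT.lowDegree pS (LSDT.nbhdClass (LSDT.uig ε μ) imax) ES).card : ℝ)))) := by
        simp only [LSDT.subsetExp_add, LSDT.subsetExp_const_mul, LSDT.subsetExp_const]
        ring
    _ ≤ (Δmax * (A + D) * Real.log T) * 1 +
          (Δmax * (A * Real.log T * 8 / pS + Real.log T + ν * (D * Real.log T)) +
          (Δmax * A * Real.log T * (4 / pS) + Δmax * A * Real.log T * (4 / pS))) := by
        have h1 := hclass imin
        have h2 := hclass imax
        gcongr
    _ = Δmax * (A * (1 + 16 / pS) + 1 + D * (1 + ν)) * Real.log T := by ring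
    _ ≤ Δmax * (A * (1 + 16 / pS) + 1 + D) * (1 + ν) * Real.log T := by
        refine mul_le_mul_of_nonneg_right ?_ hl0
        rw [mul_assoc Δmax _ (1 + ν)]
        refine mul_le_mul_of_nonneg_left ?_ hΔmax
        have : 0 ≤ (A * (1 + 16 / pS) + 1) * ν := by positivity
        linarith
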